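/- Let $\mathcal X$ be a finite set, $\mathcal H$ a finite-dimensional complex Hilbert space, and let $W:\mathcal X\to\mathcal S(\mathcal H)$, $x\mapsto W_x$, be a classical–quantum channel, i.e. every $W_x$ is a density operator (positive semidefinite, trace one) on $\mathcal H$. Its memoryless $n$-block extension is $W^n_{x^n}=W_{x_1}\otimes\cdots\otimes W_{x_n}$ on $\mathcal H^{\otimes n}$, and for a probability distribution $P$ on $\mathcal X^n$ put $PW^n=\sum_{x^n}P(x^n)W^n_{x^n}$. Fix a base $b>1$ (for instance $b=2$ or $b=e$), write $\exp(t)=b^t$ and $\log=\log_b$. The Holevo capacity is $$C(W)=\max_{P}\Big[H\Big(\sum_{x}P(x)W_x\Big)-\sum_{x}P(x)H(W_x)\Big],\qquad H(\rho)=-\operatorname{Tr}\rho\log\rho,$$ the maximum being over all probability distributions $P$ on $\mathcal X$. An $(n,N,\lambda_1,\lambda_2)$ quantum identification code is a family $(P_i,D_i)_{i=1}^N$ of probability distributions $P_i$ on $\mathcal X^n$ and operators $0\le D_i\le\mathbb 1$ on $\mathcal H^{\otimes n}$ (not required to be simultaneously measurable) such that $$\operatorname{Tr}\big(P_iW^n(\mathbb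 1-D_i)\big)\le\lambda_1,\qquad \operatorname{Tr}\big(P_jW^n D_i\big)\le\lambda_2\qquad\text{for all } i\ne j;$$ $N(n,\lambda_1,\lambda_2)$ is the maximal $N$ for which such a code exists. **Theorem (strong converse for quantum identification).** Let $\lambda_1,\lambda_2>0$ with $\lambda_1+\lambda_2<1$. For every $\delta>0$ and all sufficiently large $n$, the maximum $N(n,\lambda_1,\lambda_2)$ is finite and $$N(n,\lambda_1,\lambda_2)\le\exp\big(\exp(n(C(W)+\delta))\big).$$ In particular the classical strong converse holds: if $V(y|x)$ is a classical channel with finite input and output alphabets $\mathcal X,\mathcal Y$, $C(V)$ is its Shannon capacity (to the base $b$), and $N(n,\lambda_1,\lambda_2)$ is the maximal $N$ for which there are probability distributions $P_i$ on $\mathcal X^n$ and sets $\mathcal D_i\subset\mathcal Y^n$, $i=1,\dots,N$, with $P_iV^n(\mathcal D_i^c)\le\lambda_1$ and $P_jV^n(\mathcal D_i)\le\lambda_2$ for all $i\ne j$, then for every $\delta>0$ and all sufficiently large $n$ again $N(n,\lambda_1,\lambda_2)\le\exp(\exp(n(C(V)+\delta)))$. -/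

import Mathlib

open scoped BigOperators Matrix ComplexOrder

noncomputable section

namespace QID

/-! ### Classical–quantum channels

A finite-dimensional complex Hilbert space with a fixed orthonormal basis indexed by `ι` is `ℂ^ι`;
its operators are the matrices over `ι`, and the operators of its `n`-fold tensor power are the
matrices over `Fin n → ι`. Probability distributions on a finite set `X` are the elements of
`stdSimplex ℝ X`. All entropies are taken to the logarithmic base `b`. -/

/-- A classical–quantum channel: a map from a finite alphabet to density operators. -/
structure CQChannel (X ι : Type*) [Fintype X] [Fintype ι] where
  /-- The output state `W_x` for the input letter `x`. -/
  state : X → Matrix ι ι ℂ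
  posSemidef : ∀ x, (state x).PosSemidef
  trace_eq_one : ∀ x, (state x).trace = 1

/-- The von Neumann entropy `-Tr (ρ log ρ)` to the base `b`. The logarithm of `ρ` is given by the
functional calculus; `Real.logb b 0 = 0` implements the convention `0 log 0 = 0`. -/
def vonNeumannEntropy {ι : Type*} [Fintype ι] [DecidableEq ι] (b : ℝ) (ρ : Matrix ι ι ℂ) : ℝ :=
  -(ρ * cfc (Real.logb b) ρ).trace.re

/-- The tensor product `A 0 ⊗ ⋯ ⊗ A (n - 1)` of operators on `ℂ^ι`, as an operator on the `n`-fold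
tensor power (an iterated Kronecker product). -/
def tensorProd {ι : Type*} {n : ℕ} (A : Fin n → Matrix ι ι ℂ) :
    Matrix (Fin n → ι) (Fin n → ι) ℂ :=
  Matrix.of fun i j => ∏ k, A k (i k) (j k)

namespace CQChannel

variable {X ι : Type*} [Fintype X] [Fintype ι]

/-- The output state `PW = ∑ x, P(x) W_x`. -/
def output (W : CQChannel X ι) (P : X → ℝ) : Matrix ι ι ℂ :=
  ∑ x, (P x : ℂ) • W.state x

/-- The `n`-block output state `W_{x_1} ⊗ ⋯ ⊗ W_{x_n}`. -/
def blockState (W : CQChannel X ι) {n : ℕ} (x : Fin n → X) : Matrix (Fin n → ι) (Fin n → ι) ℂ :=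
  tensorProd fun k => W.state (x k)

/-- The `n`-block output state `P W^n = ∑ x^n, P(x^n) W^n_{x^n}`. -/
def blockOutput (W : CQChannel X ι) {n : ℕ} (P : (Fin n → X) → ℝ) :
    Matrix (Fin n → ι) (Fin n → ι) ℂ :=
  ∑ x, (P x : ℂ) • W.blockState x

variable [DecidableEq ι]

/-- The von Neumann mutual information `I(P;W) = H(PW) - ∑ x, P(x) H(W_x)`. -/
def mutualInfo (b : ℝ) (W : CQChannel X ι) (P : X → ℝ) : ℝ :=
  vonNeumannEntropy b (W.output P) - ∑ x, P x * vonNeumannEntropy b (W.state x)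

/-- The Holevo capacity `C(W) = max_P I(P;W)`, over all probability distributions `P` on `X`. -/
def capacity (b : ℝ) (W : CQChannel X ι) : ℝ :=
  sSup (W.mutualInfo b '' stdSimplex ℝ X)

/-- `(P_i, D_i)`, `i < N`, is an `(n, N, l₁, l₂)` quantum identification code for `W`. -/
structure IsQIDCode (W : CQChannel X ι) (n N : ℕ) (l₁ l₂ : ℝ)
    (P : Fin N → (Fin n → X) → ℝ) (D : Fin N → Matrix (Fin n → ι) (Fin n → ι) ℂ) : Prop where
  prob : ∀ i, P i ∈ stdSimplex ℝ (Fin n → X)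
  nonneg : ∀ i, (D i).PosSemidef
  le_one : ∀ i, (1 - D i).PosSemidef
  first_kind : ∀ i, (W.blockOutput (P i) * (1 - D i)).trace.re ≤ l₁
  second_kind : ∀ i j, i ≠ j → (W.blockOutput (P j) * D i).trace.re ≤ l₂

/-- The sizes `N` for which an `(n, N, l₁, l₂)` quantum identification code exists. -/
def qidSizes (W : CQChannel X ι) (n : ℕ) (l₁ l₂ : ℝ) : Set ℕ :=
  {N | ∃ P D, W.IsQIDCode n N l₁ l₂ P D}

/-- The maximal size `N(n, l₁, l₂)` of a quantum identification code (meaningful when the set of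
sizes is bounded; it always contains `0`). -/
def maxQIDSize (W : CQChannel X ι) (n : ℕ) (l₁ l₂ : ℝ) : ℕ :=
  sSup (W.qidSizes n l₁ l₂)

end CQChannel

/-! ### Classical channels -/

/-- A classical channel: a stochastic matrix `W(y|x)`. -/
structure ClassicalChannel (X Y : Type*) [Fintype X] [Fintype Y] where
  /-- The transition probability `W(y|x)`, with arguments `x` and `y`. -/
  prob : X → Y → ℝ
  prob_mem : ∀ x, prob x ∈ stdSimplex ℝ Y

/-- The Shannon entropy to the base `b`. -/
def shannonEntropy {Y : Type*} [Fintype Y] (b : ℝ) (p : Y → ℝ) : ℝ :=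
  -∑ y, p y * Real.logb b (p y)

namespace ClassicalChannel

variable {X Y : Type*} [Fintype X] [Fintype Y]

/-- The output distribution `PW`. -/
def output (W : ClassicalChannel X Y) (P : X → ℝ) : Y → ℝ :=
  fun y => ∑ x, P x * W.prob x y

/-- Shannon's mutual information `I(P;W) = H(PW) - ∑ x, P(x) H(W(·|x))`. -/
def mutualInfo (b : ℝ) (W : ClassicalChannel X Y) (P : X → ℝ) : ℝ :=
  shannonEntropy b (W.output P) - ∑ x, P x * shannonEntropy b (W.prob x)

/-- The Shannon capacity `C(W) = max_P I(P;W)`. -/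
def capacity (b : ℝ) (W : ClassicalChannel X Y) : ℝ :=
  sSup (W.mutualInfo b '' stdSimplex ℝ X)

/-- The probability `PW^n(A)` of the event `A` under the `n`-block output distribution `PW^n` of the
memoryless channel. -/
def blockProb (W : ClassicalChannel X Y) {n : ℕ} (P : (Fin n → X) → ℝ)
    (A : Finset (Fin n → Y)) : ℝ :=
  ∑ x, P x * ∑ y ∈ A, ∏ k, W.prob (x k) (y k)

variable [DecidableEq Y]

/-- `(P_i, D_i)`, `i < N`, is an `(n, N, l₁, l₂)` identification code for `W`. -/
structure IsIDCode (W : ClassicalChannel X Y) (n N : ℕ) (l₁ l₂ : ℝ)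
    (P : Fin N → (Fin n → X) → ℝ) (D : Fin N → Finset (Fin n → Y)) : Prop where
  prob : ∀ i, P i ∈ stdSimplex ℝ (Fin n → X)
  first_kind : ∀ i, W.blockProb (P i) (D i)ᶜ ≤ l₁
  second_kind : ∀ i j, i ≠ j → W.blockProb (P j) (D i) ≤ l₂

/-- The sizes `N` for which an `(n, N, l₁, l₂)` identification code exists. -/
def idSizes (W : ClassicalChannel X Y) (n : ℕ) (l₁ l₂ : ℝ) : Set ℕ :=
  {N | ∃ P D, W.IsIDCode n N l₁ l₂ P D}

/-- The maximal size `N(n, l₁, l₂)` of an identification code (meaningful when the set of sizes is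
bounded; it always contains `0`). -/
def maxIDSize (W : ClassicalChannel X Y) (n : ℕ) (l₁ l₂ : ℝ) : ℕ :=
  sSup (W.idSizes n l₁ l₂)

end ClassicalChannel

end QID

end

noncomputable section

namespace QID

/-! ### Traces of functions of Hermitian matrices -/

section Matrix

open Matrix Filter Topology

variable {ι : Type*} [Fintype ι] [DecidableEq ι] {A B ρ : Matrix ι ι ℂ}

/-- The unitary matrix of scalar products between the eigenvectors of `A` and those of `ρ`. -/
def overlap (hA : A.IsHermitian) (hρ : ρ.IsHermitian) : Matrix ι ι ℂ :=
  (hA.eigenvectorUnitary : Matrix ι ι ℂ)ᴴ * (hρ.eigenvectorUnitary : Matrix ι ι ℂ)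

theorem eigenvectorUnitary_conjTranspose_mul_self (hA : A.IsHermitian) :
    (hA.eigenvectorUnitary : Matrix ι ι ℂ)ᴴ * (hA.eigenvectorUnitary : Matrix ι ι ℂ) = 1 :=
  Unitary.coe_star_mul_self hA.eigenvectorUnitary

theorem eigenvectorUnitary_mul_conjTranspose_self (hA : A.IsHermitian) :
    (hA.eigenvectorUnitary : Matrix ι ι ℂ) * (hA.eigenvectorUnitary : Matrix ι ι ℂ)ᴴ = 1 :=
  Unitary.coe_mul_star_self hA.eigenvectorUnitary

theorem eq_eigenvectorUnitary_mul_diagonal_mul (hA : A.IsHermitian) :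
    A = (hA.eigenvectorUnitary : Matrix ι ι ℂ) * diagonal (fun i => (hA.eigenvalues i : ℂ)) *
      (hA.eigenvectorUnitary : Matrix ι ι ℂ)ᴴ := by
  conv_lhs => rw [hA.spectral_theorem, Unitary.conjStarAlgAut_apply]
  rfl

theorem overlap_mul_conjTranspose (hA : A.IsHermitian) (hρ : ρ.IsHermitian) :
    overlap hA hρ * (overlap hA hρ)ᴴ = 1 := by
  rw [overlap, conjTranspose_mul, conjTranspose_conjTranspose, Matrix.mul_assoc,
    ← Matrix.mul_assoc _ _ (hA.eigenvectorUnitary : Matrix ι ι ℂ),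
    eigenvectorUnitary_mul_conjTranspose_self, Matrix.one_mul,
    eigenvectorUnitary_conjTranspose_mul_self]

theorem conjTranspose_mul_overlap (hA : A.IsHermitian) (hρ : ρ.IsHermitian) :
    (overlap hA hρ)ᴴ * overlap hA hρ = 1 :=
  mul_eq_one_comm.1 (overlap_mul_conjTranspose hA hρ)

theorem sum_norm_sq_eq_mul_conjTranspose {κ ν : Type*} [Fintype ν] (G : Matrix κ ν ℂ) (i : κ) :
    ((∑ j, ‖G i j‖ ^ 2 : ℝ) : ℂ) = (G * Gᴴ) i i := by
  simp [Matrix.mul_apply, Complex.mul_conj, Complex.normSq_eq_norm_sq]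

theorem sum_norm_sq_eq_conjTranspose_mul {κ ν : Type*} [Fintype κ] (G : Matrix κ ν ℂ) (j : ν) :
    ((∑ i, ‖G i j‖ ^ 2 : ℝ) : ℂ) = (Gᴴ * G) j j := by
  simp [Matrix.mul_apply, ← Complex.normSq_eq_conj_mul_self, Complex.normSq_eq_norm_sq]

theorem overlap_row (hA : A.IsHermitian) (hρ : ρ.IsHermitian) (i : ι) :
    ∑ j, ‖overlap hA hρ i j‖ ^ 2 = 1 := by
  have h := sum_norm_sq_eq_mul_conjTranspose (overlap hA hρ) i
  rw [overlap_mul_conjTranspose, one_apply_eq] at h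
  exact_mod_cast h

theorem overlap_col (hA : A.IsHermitian) (hρ : ρ.IsHermitian) (j : ι) :
    ∑ i, ‖overlap hA hρ i j‖ ^ 2 = 1 := by
  have h := sum_norm_sq_eq_conjTranspose_mul (overlap hA hρ) j
  rw [conjTranspose_mul_overlap, one_apply_eq] at h
  exact_mod_cast h

/-- The square root of `ρ`, as a matrix from the eigenbasis of `ρ` to that of `A`. -/
def sqrtOverlap (hA : A.IsHermitian) (hρ : ρ.IsHermitian) : Matrix ι ι ℂ :=
  overlap hA hρ * diagonal (fun j => ((√(hρ.eigenvalues j) : ℝ) : ℂ))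

theorem diagonal_sqrt_eigenvalues_mul_self (hρ : ρ.PosSemidef) :
    diagonal (fun j => ((√(hρ.1.eigenvalues j) : ℝ) : ℂ)) *
      diagonal (fun j => ((√(hρ.1.eigenvalues j) : ℝ) : ℂ)) =
      diagonal (fun j => (hρ.1.eigenvalues j : ℂ)) := by
  rw [diagonal_mul_diagonal]
  congr 1
  funext j
  rw [← Complex.ofReal_mul, Real.mul_self_sqrt (hρ.eigenvalues_nonneg j)]

theorem diagonal_sqrt_eigenvalues_conjTranspose (hρ : ρ.IsHermitian) :
    (diagonal (fun j => ((√(hρ.eigenvalues j) : ℝ) : ℂ)))ᴴ =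
      diagonal (fun j => ((√(hρ.eigenvalues j) : ℝ) : ℂ)) := by
  rw [diagonal_conjTranspose]
  congr 1
  funext j
  simp

theorem sqrtOverlap_mul_conjTranspose (hA : A.IsHermitian) (hρ : ρ.PosSemidef) :
    sqrtOverlap hA hρ.1 * (sqrtOverlap hA hρ.1)ᴴ =
      (hA.eigenvectorUnitary : Matrix ι ι ℂ)ᴴ * ρ * (hA.eigenvectorUnitary : Matrix ι ι ℂ) := by
  rw [sqrtOverlap, conjTranspose_mul, diagonal_sqrt_eigenvalues_conjTranspose, Matrix.mul_assoc,
    ← Matrix.mul_assoc (diagonal _), diagonal_sqrt_eigenvalues_mul_self hρ, overlap,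
    conjTranspose_mul, conjTranspose_conjTranspose]
  conv_rhs => rw [eq_eigenvectorUnitary_mul_diagonal_mul hρ.1]
  simp only [Matrix.mul_assoc]

theorem conjTranspose_mul_sqrtOverlap (hA : A.IsHermitian) (hρ : ρ.PosSemidef) :
    (sqrtOverlap hA hρ.1)ᴴ * sqrtOverlap hA hρ.1 =
      diagonal (fun j => (hρ.1.eigenvalues j : ℂ)) := by
  rw [sqrtOverlap, conjTranspose_mul, diagonal_sqrt_eigenvalues_conjTranspose, Matrix.mul_assoc,
    ← Matrix.mul_assoc _ (overlap hA hρ.1), conjTranspose_mul_overlap, Matrix.one_mul,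
    diagonal_sqrt_eigenvalues_mul_self hρ]

theorem norm_sqrtOverlap_sq (hA : A.IsHermitian) (hρ : ρ.PosSemidef) (i j : ι) :
    ‖sqrtOverlap hA hρ.1 i j‖ ^ 2 = ‖overlap hA hρ.1 i j‖ ^ 2 * hρ.1.eigenvalues j := by
  rw [sqrtOverlap, mul_diagonal, norm_mul, mul_pow, Complex.norm_real, Real.norm_eq_abs, sq_abs,
    Real.sq_sqrt (hρ.eigenvalues_nonneg j)]

theorem trace_mul_cfc (hA : A.IsHermitian) (ρ : Matrix ι ι ℂ) (f : ℝ → ℝ) :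
    (ρ * cfc f A).trace = ∑ i, ((hA.eigenvectorUnitary : Matrix ι ι ℂ)ᴴ * ρ *
      (hA.eigenvectorUnitary : Matrix ι ι ℂ)) i i * (f (hA.eigenvalues i) : ℂ) := by
  have h : cfc f A = (hA.eigenvectorUnitary : Matrix ι ι ℂ) *
      diagonal (fun i => (f (hA.eigenvalues i) : ℂ)) *
      (hA.eigenvectorUnitary : Matrix ι ι ℂ)ᴴ := by
    rw [hA.cfc_eq, IsHermitian.cfc, Unitary.conjStarAlgAut_apply]
    rfl
  rw [h, ← Matrix.mul_assoc, trace_mul_comm, ← Matrix.mul_assoc, ← Matrix.mul_assoc, trace]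
  simp only [diag_apply, mul_diagonal]

theorem re_trace_mul_cfc (hA : A.IsHermitian) (hρ : ρ.PosSemidef) (f : ℝ → ℝ) :
    (ρ * cfc f A).trace.re =
      ∑ i, ∑ j, ‖sqrtOverlap hA hρ.1 i j‖ ^ 2 * f (hA.eigenvalues i) := by
  rw [trace_mul_cfc hA, ← sqrtOverlap_mul_conjTranspose hA hρ]
  simp only [← sum_norm_sq_eq_mul_conjTranspose, ← Complex.ofReal_mul, ← Complex.ofReal_sum,
    Complex.ofReal_re, Finset.sum_mul]

theorem re_trace_mul_cfc_self (hρ : ρ.PosSemidef) (f : ℝ → ℝ) :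
    (ρ * cfc f ρ).trace.re = ∑ j, hρ.1.eigenvalues j * f (hρ.1.eigenvalues j) := by
  have h : (hρ.1.eigenvectorUnitary : Matrix ι ι ℂ)ᴴ * ρ *
      (hρ.1.eigenvectorUnitary : Matrix ι ι ℂ) =
      diagonal (fun i => (hρ.1.eigenvalues i : ℂ)) := by
    rw [← sqrtOverlap_mul_conjTranspose hρ.1 hρ, sqrtOverlap, overlap,
      eigenvectorUnitary_conjTranspose_mul_self, Matrix.one_mul,
      diagonal_sqrt_eigenvalues_conjTranspose, diagonal_sqrt_eigenvalues_mul_self hρ]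
  rw [trace_mul_cfc hρ.1, h]
  simp only [diagonal_apply_eq, ← Complex.ofReal_mul, ← Complex.ofReal_sum, Complex.ofReal_re]

theorem re_trace_mul_cfc_self_eq_sum_overlap (hA : A.IsHermitian) (hρ : ρ.PosSemidef)
    (f : ℝ → ℝ) :
    (ρ * cfc f ρ).trace.re =
      ∑ i, ∑ j, ‖sqrtOverlap hA hρ.1 i j‖ ^ 2 * f (hρ.1.eigenvalues j) := by
  rw [re_trace_mul_cfc_self hρ, Finset.sum_comm]
  refine Finset.sum_congr rfl fun j _ => ?_
  simp only [norm_sqrtOverlap_sq hA hρ]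
  rw [← Finset.sum_mul, ← Finset.sum_mul, overlap_col, one_mul]

theorem re_trace_eq_sum_eigenvalues (hA : A.IsHermitian) :
    A.trace.re = ∑ i, hA.eigenvalues i := by
  rw [hA.trace_eq_sum_eigenvalues]
  simp

/-- Klein's inequality. -/
theorem re_trace_mul_log_le_of_posDef (hρ : ρ.PosSemidef) (hA : A.PosDef) :
    (ρ * cfc Real.log A).trace.re ≤
      (ρ * cfc Real.log ρ).trace.re + (A.trace.re - ρ.trace.re) := by
  rw [re_trace_mul_cfc hA.1 hρ, re_trace_mul_cfc_self_eq_sum_overlap hA.1 hρ,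
    re_trace_eq_sum_eigenvalues hA.1, re_trace_eq_sum_eigenvalues hρ.1]
  have h₁ : ∑ i, hA.1.eigenvalues i =
      ∑ i, ∑ j, ‖overlap hA.1 hρ.1 i j‖ ^ 2 * hA.1.eigenvalues i := by
    simp [← Finset.sum_mul, overlap_row]
  have h₂ : ∑ j, hρ.1.eigenvalues j =
      ∑ i, ∑ j, ‖overlap hA.1 hρ.1 i j‖ ^ 2 * hρ.1.eigenvalues j := by
    rw [Finset.sum_comm]
    simp [← Finset.sum_mul, overlap_col]
  rw [h₁, h₂, ← Finset.sum_sub_distrib, ← Finset.sum_add_distrib]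
  refine Finset.sum_le_sum fun i _ => ?_
  rw [← Finset.sum_sub_distrib, ← Finset.sum_add_distrib]
  refine Finset.sum_le_sum fun j _ => ?_
  rw [norm_sqrtOverlap_sq hA.1 hρ]
  have ha := hA.eigenvalues_pos i
  have hg : 0 ≤ ‖overlap hA.1 hρ.1 i j‖ ^ 2 := by positivity
  rcases (hρ.eigenvalues_nonneg j).eq_or_lt with hw | hw
  · rw [← hw]
    simp only [mul_zero, zero_mul, zero_add, sub_zero]
    positivity
  · have h := Real.log_le_sub_one_of_pos (div_pos ha hw)
    rw [Real.log_div ha.ne' hw.ne'] at h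
    have h' : hρ.1.eigenvalues j * (hA.1.eigenvalues i / hρ.1.eigenvalues j) =
        hA.1.eigenvalues i := by field_simp
    have := mul_le_mul_of_nonneg_left (mul_le_mul_of_nonneg_left h hw.le) hg
    nlinarith

theorem re_trace_mul_nonneg (hA : A.PosSemidef) (hB : B.PosSemidef) :
    0 ≤ (A * B).trace.re := by
  have h := re_trace_mul_cfc hB.1 hA id
  rw [cfc_id ℝ B (show IsSelfAdjoint B from hB.1)] at h
  rw [h]
  exact Finset.sum_nonneg fun i _ => Finset.sum_nonneg fun j _ =>
    mul_nonneg (by positivity) (hB.eigenvalues_nonneg i)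

/-- The logarithm is operator monotone. -/
theorem posSemidef_log_sub_log (hA : A.PosDef) (h : (B - A).PosSemidef) :
    (cfc Real.log B - cfc Real.log A).PosSemidef := by
  open scoped Matrix.Norms.L2Operator MatrixOrder in
  exact CFC.log_le_log (a := A) (b := B) (Matrix.le_iff.2 h) hA.isStrictlyPositive

theorem cfc_add_smul_one (hA : A.IsHermitian) (f : ℝ → ℝ) (e : ℝ) :
    cfc f (A + (e : ℂ) • (1 : Matrix ι ι ℂ)) = cfc (fun x => f (x + e)) A := by
  have hA' : IsSelfAdjoint A := hA
  have h : cfc (fun x : ℝ => x + e) A = A + (e : ℂ) • (1 : Matrix ι ι ℂ) := by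
    rw [cfc_add_const e (fun x => x) A, cfc_id' ℝ A, Algebra.algebraMap_eq_smul_one]
    rfl
  rw [← h]
  exact (cfc_comp f (fun x => x + e) A hA'
    ((Matrix.finite_real_spectrum.image _).continuousOn _)
    (Matrix.finite_real_spectrum.continuousOn _)).symm

theorem tendsto_re_trace_mul_log (hρ : ρ.PosSemidef) (hA : A.PosSemidef) {c : ℝ} (hc : 0 < c)
    (h : (A - (c : ℂ) • ρ).PosSemidef) :
    Tendsto (fun e : ℝ => (ρ * cfc Real.log (A + (e : ℂ) • (1 : Matrix ι ι ℂ))).trace.re)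
      (𝓝[>] 0) (𝓝 (ρ * cfc Real.log A).trace.re) := by
  simp only [cfc_add_smul_one hA.1, re_trace_mul_cfc hA.1 hρ, ← Finset.sum_mul]
  refine tendsto_finsetSum _ fun i _ => ?_
  rcases (hA.eigenvalues_nonneg i).eq_or_lt with ha | ha
  · have h0 : ∑ j, ‖sqrtOverlap hA.1 hρ.1 i j‖ ^ 2 = 0 := by
      have h1 := (h.conjTranspose_mul_mul_same
        (hA.1.eigenvectorUnitary : Matrix ι ι ℂ)).diag_nonneg (i := i)
      rw [Matrix.mul_sub, Matrix.sub_mul, Matrix.mul_smul, Matrix.smul_mul,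
        ← sqrtOverlap_mul_conjTranspose hA.1 hρ, Matrix.sub_apply, Matrix.smul_apply,
        ← sqrtOverlap_mul_conjTranspose hA.1 hA, ← sum_norm_sq_eq_mul_conjTranspose,
        ← sum_norm_sq_eq_mul_conjTranspose, smul_eq_mul, ← Complex.ofReal_mul,
        ← Complex.ofReal_sub, Complex.zero_le_real] at h1
      have h2 : ∑ j, ‖sqrtOverlap hA.1 hA.1 i j‖ ^ 2 = 0 := by
        refine Finset.sum_eq_zero fun j _ => ?_
        rw [norm_sqrtOverlap_sq hA.1 hA]
        by_cases hij : i = j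
        · rw [← hij, ← ha, mul_zero]
        · rw [overlap, eigenvectorUnitary_conjTranspose_mul_self, one_apply_ne hij]
          simp
      rw [h2] at h1
      have h3 : 0 ≤ ∑ j, ‖sqrtOverlap hA.1 hρ.1 i j‖ ^ 2 := by positivity
      nlinarith
    simp [h0]
  · refine Tendsto.const_mul _ (tendsto_nhdsWithin_of_tendsto_nhds ?_)
    have : ContinuousAt (fun e : ℝ => Real.log (hA.1.eigenvalues i + e)) 0 := by
      refine ContinuousAt.log (by fun_prop) ?_
      simpa using ha.ne'
    simpa using this.tendsto

theorem posDef_add_smul_one {κ : Type*} [DecidableEq κ] {A : Matrix κ κ ℂ} (hA : A.PosSemidef)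
    {e : ℝ} (he : 0 < e) : (A + (e : ℂ) • (1 : Matrix κ κ ℂ)).PosDef :=
  Matrix.PosDef.posSemidef_add hA (Matrix.PosDef.one.smul (by exact_mod_cast he))

/-- Klein's inequality for a possibly singular `A` whose support contains that of `ρ`. -/
theorem re_trace_mul_log_le (hρ : ρ.PosSemidef) (hA : A.PosSemidef) {c : ℝ} (hc : 0 < c)
    (h : (A - (c : ℂ) • ρ).PosSemidef) :
    (ρ * cfc Real.log A).trace.re ≤
      (ρ * cfc Real.log ρ).trace.re + (A.trace.re - ρ.trace.re) := by
  have h₁ : Tendsto (fun e : ℝ => (ρ * cfc Real.log ρ).trace.re +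
      ((A + (e : ℂ) • (1 : Matrix ι ι ℂ)).trace.re - ρ.trace.re)) (𝓝[>] 0)
      (𝓝 ((ρ * cfc Real.log ρ).trace.re + (A.trace.re - ρ.trace.re))) := by
    refine tendsto_nhdsWithin_of_tendsto_nhds ?_
    have : Continuous (fun e : ℝ => (ρ * cfc Real.log ρ).trace.re +
      ((A + (e : ℂ) • (1 : Matrix ι ι ℂ)).trace.re - ρ.trace.re)) := by
      simp only [trace_add, trace_smul]
      fun_prop
    simpa using this.tendsto 0
  refine le_of_tendsto_of_tendsto (tendsto_re_trace_mul_log hρ hA hc h) h₁ ?_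
  filter_upwards [self_mem_nhdsWithin] with e he
  exact re_trace_mul_log_le_of_posDef hρ (posDef_add_smul_one hA he)

theorem re_trace_mul_log_mono (hρ : ρ.PosSemidef) (hA : A.PosSemidef) {c : ℝ} (hc : 0 < c)
    (h : (A - (c : ℂ) • ρ).PosSemidef) (hAB : (B - A).PosSemidef) :
    (ρ * cfc Real.log A).trace.re ≤ (ρ * cfc Real.log B).trace.re := by
  have hB : B.PosSemidef := by simpa using hAB.add hA
  have hB' : (B - (c : ℂ) • ρ).PosSemidef := by simpa using hAB.add h
  refine le_of_tendsto_of_tendsto (tendsto_re_trace_mul_log hρ hA hc h)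
    (tendsto_re_trace_mul_log hρ hB hc hB') ?_
  filter_upwards [self_mem_nhdsWithin] with e he
  have h₁ := re_trace_mul_nonneg hρ (posSemidef_log_sub_log (posDef_add_smul_one hA he)
    (B := B + (e : ℂ) • (1 : Matrix ι ι ℂ)) (by simpa using hAB))
  rw [Matrix.mul_sub, trace_sub, Complex.sub_re] at h₁
  linarith

end Matrix

/-! ### Mutual information and relative entropy -/

section Capacity

open Matrix

variable {X ι : Type*} [Fintype X] [Fintype ι]

theorem CQChannel.output_posSemidef (W : CQChannel X ι) {P : X → ℝ} (hP : ∀ x, 0 ≤ P x) :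
    (W.output P).PosSemidef :=
  posSemidef_sum _ fun x _ => (W.posSemidef x).smul (by exact_mod_cast hP x)

theorem CQChannel.trace_output (W : CQChannel X ι) {P : X → ℝ} (hP : P ∈ stdSimplex ℝ X) :
    (W.output P).trace = 1 := by
  simp only [CQChannel.output, trace_sum, trace_smul, W.trace_eq_one, smul_eq_mul, mul_one]
  exact_mod_cast hP.2

theorem CQChannel.output_mix [DecidableEq X] (W : CQChannel X ι) (P : X → ℝ) (t : ℝ) (x : X) :
    W.output (fun y => (1 - t) * P y + t * Pi.single (M := fun _ => ℝ) x 1 y) =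
      ((1 - t : ℝ) : ℂ) • W.output P + (t : ℂ) • W.state x := by
  simp only [CQChannel.output, Complex.ofReal_add, Complex.ofReal_mul, add_smul, mul_smul,
    Finset.sum_add_distrib, Finset.smul_sum]
  congr 1
  rw [Finset.sum_eq_single x]
  · simp
  · intro y _ hy
    simp [hy]
  · simp

theorem mix_mem_stdSimplex [DecidableEq X] {P : X → ℝ} (hP : P ∈ stdSimplex ℝ X) {t : ℝ}
    (h0 : 0 ≤ t) (h1 : t ≤ 1) (x : X) :
    (fun y => (1 - t) * P y + t * Pi.single (M := fun _ => ℝ) x 1 y) ∈ stdSimplex ℝ X := by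
  have := convex_stdSimplex ℝ X hP (single_mem_stdSimplex ℝ x) (sub_nonneg.2 h1) h0 (by ring)
  exact this

variable [DecidableEq ι]

theorem vonNeumannEntropy_eq (b : ℝ) {ρ : Matrix ι ι ℂ} (hρ : ρ.PosSemidef) :
    vonNeumannEntropy b ρ = -(ρ * cfc Real.log ρ).trace.re / Real.log b := by
  rw [vonNeumannEntropy, re_trace_mul_cfc_self hρ, re_trace_mul_cfc_self hρ, neg_div,
    Finset.sum_div]
  simp only [Real.logb, mul_div_assoc]

/-- The Holevo information of `P` in natural units, `∑ x, P(x) Tr W_x log W_x - Tr PW log PW`. -/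
def CQChannel.holevoInfo (W : CQChannel X ι) (P : X → ℝ) : ℝ :=
  ∑ x, P x * (W.state x * cfc Real.log (W.state x)).trace.re -
    (W.output P * cfc Real.log (W.output P)).trace.re

theorem CQChannel.mutualInfo_eq (b : ℝ) (W : CQChannel X ι) {P : X → ℝ} (hP : ∀ x, 0 ≤ P x) :
    W.mutualInfo b P = W.holevoInfo P / Real.log b := by
  simp only [CQChannel.mutualInfo, CQChannel.holevoInfo,
    vonNeumannEntropy_eq b (W.output_posSemidef hP), vonNeumannEntropy_eq b (W.posSemidef _)]
  rw [sub_div, Finset.sum_div]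
  simp only [neg_div, mul_neg, Finset.sum_neg_distrib, mul_div_assoc]
  ring

theorem re_trace_mul_log_self_nonpos {ρ : Matrix ι ι ℂ} (hρ : ρ.PosSemidef) (h : ρ.trace = 1) :
    (ρ * cfc Real.log ρ).trace.re ≤ 0 := by
  rw [re_trace_mul_cfc_self hρ]
  refine Finset.sum_nonpos fun j _ => mul_nonpos_of_nonneg_of_nonpos (hρ.eigenvalues_nonneg j)
    (Real.log_nonpos (hρ.eigenvalues_nonneg j) ?_)
  have h₁ := re_trace_eq_sum_eigenvalues hρ.1
  rw [h, Complex.one_re] at h₁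
  rw [h₁]
  exact Finset.single_le_sum (fun i _ => hρ.eigenvalues_nonneg i) (Finset.mem_univ j)

theorem CQChannel.holevoInfo_le_card (W : CQChannel X ι) {P : X → ℝ} (hP : P ∈ stdSimplex ℝ X) :
    W.holevoInfo P ≤ Fintype.card ι := by
  have h₁ : ∑ x, P x * (W.state x * cfc Real.log (W.state x)).trace.re ≤ 0 :=
    Finset.sum_nonpos fun x _ => mul_nonpos_of_nonneg_of_nonpos (hP.1 x)
      (re_trace_mul_log_self_nonpos (W.posSemidef x) (W.trace_eq_one x))
  have h₂ := re_trace_mul_log_le_of_posDef (W.output_posSemidef hP.1)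
    (Matrix.PosDef.one (n := ι) (R := ℂ))
  have h₃ : cfc Real.log (1 : Matrix ι ι ℂ) = 0 := by
    rw [cfc_apply_one]
    simp
  rw [h₃, W.trace_output hP, Matrix.mul_zero, trace_zero, trace_one] at h₂
  simp only [Complex.zero_re, Complex.natCast_re, Complex.one_re] at h₂
  unfold CQChannel.holevoInfo
  linarith

/-- If `P` almost maximizes the Holevo information, then every letter has small relative entropy
with respect to a slight perturbation of the output state of `P`. -/
theorem CQChannel.divergence_mix_le (W : CQChannel X ι) {c η t : ℝ}
    (hc : ∀ P ∈ stdSimplex ℝ X, W.holevoInfo P ≤ c) {P : X → ℝ} (hP : P ∈ stdSimplex ℝ X)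
    (hη : 0 ≤ η) (h0 : 0 < t) (h1 : t < 1) (hPc : c - t * η ≤ W.holevoInfo P) (x : X) :
    (W.state x * cfc Real.log (W.state x)).trace.re -
      (W.state x * cfc Real.log
        (((1 - t : ℝ) : ℂ) • W.output P + (t : ℂ) • W.state x)).trace.re ≤ c + η := by
  classical
  have hmem := mix_mem_stdSimplex hP h0.le h1.le x
  have hI := hc _ hmem
  have hps := W.output_posSemidef hP.1
  have hσ : (((1 - t : ℝ) : ℂ) • W.output P + (t : ℂ) • W.state x).PosSemidef :=
    W.output_mix P t x ▸ W.output_posSemidef hmem.1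
  have hσ1 : (((1 - t : ℝ) : ℂ) • W.output P + (t : ℂ) • W.state x).trace = 1 :=
    W.output_mix P t x ▸ W.trace_output hmem
  rw [CQChannel.holevoInfo, W.output_mix] at hI
  set σ := ((1 - t : ℝ) : ℂ) • W.output P + (t : ℂ) • W.state x with hσdef
  have hK := re_trace_mul_log_le hps hσ (c := 1 - t) (by linarith) (by
    rw [hσdef, add_sub_cancel_left]
    exact (W.posSemidef x).smul (by exact_mod_cast h0.le))
  rw [hσ1, W.trace_output hP, sub_self, add_zero] at hK
  have hsum : ∑ y, ((1 - t) * P y + t * Pi.single (M := fun _ => ℝ) x 1 y) *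
      (W.state y * cfc Real.log (W.state y)).trace.re =
      (1 - t) * ∑ y, P y * (W.state y * cfc Real.log (W.state y)).trace.re +
        t * (W.state x * cfc Real.log (W.state x)).trace.re := by
    simp only [add_mul, Finset.sum_add_distrib, Finset.mul_sum, mul_assoc]
    congr 1
    rw [Finset.sum_eq_single x]
    · simp
    · intro y _ hy
      simp [hy]
    · simp
  have hlog : (σ * cfc Real.log σ).trace.re =
      (1 - t) * (W.output P * cfc Real.log σ).trace.re +
        t * (W.state x * cfc Real.log σ).trace.re := by
    conv_lhs => rw [hσdef, Matrix.add_mul, Matrix.smul_mul, Matrix.smul_mul, ← hσdef]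
    simp only [trace_add, trace_smul, Complex.add_re, smul_eq_mul, Complex.re_ofReal_mul]
  rw [hsum, hlog] at hI
  rw [CQChannel.holevoInfo] at hPc
  have h2 : (1 - t) * (W.output P * cfc Real.log σ).trace.re ≤
      (1 - t) * (W.output P * cfc Real.log (W.output P)).trace.re :=
    mul_le_mul_of_nonneg_left hK (by linarith)
  have h3 : (1 - t) * (c - t * η) ≤ (1 - t) *
      (∑ y, P y * (W.state y * cfc Real.log (W.state y)).trace.re -
        (W.output P * cfc Real.log (W.output P)).trace.re) :=
    mul_le_mul_of_nonneg_left hPc (by linarith)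
  have h4 : t * ((W.state x * cfc Real.log (W.state x)).trace.re -
      (W.state x * cfc Real.log σ).trace.re) ≤ t * (c + η) := by
    nlinarith [mul_nonneg (mul_nonneg h0.le h0.le) hη]
  exact le_of_mul_le_mul_left h4 h0

/-- There is an invertible state with respect to which every output state has relative entropy at
most `c + δ`; the state is `S`, up to normalization. -/
theorem CQChannel.exists_posDef_divergence_le (W : CQChannel X ι) {c : ℝ}
    (hc : IsLUB (W.holevoInfo '' stdSimplex ℝ X) c) {δ : ℝ} (hδ : 0 < δ) :
    ∃ S : Matrix ι ι ℂ, S.PosDef ∧ ∀ x, (W.state x * cfc Real.log (W.state x)).trace.re -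
      (W.state x * cfc Real.log S).trace.re + Real.log S.trace.re ≤ c + δ := by
  have hub : ∀ P ∈ stdSimplex ℝ X, W.holevoInfo P ≤ c := fun P hP => hc.1 ⟨P, hP, rfl⟩
  set m : ℝ := Fintype.card X + Fintype.card ι with hm
  have hm0 : 0 ≤ m := by positivity
  obtain ⟨t, h0, h1, htm⟩ : ∃ t : ℝ, 0 < t ∧ t < 1 ∧ t * m ≤ δ / 2 := by
    refine ⟨min (1 / 2) (δ / 2 / (m + 1)), by positivity, ?_, ?_⟩
    · exact (min_le_left _ _).trans_lt (by norm_num)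
    · calc _ ≤ δ / 2 / (m + 1) * m := by gcongr; exact min_le_right _ _
        _ ≤ δ / 2 / (m + 1) * (m + 1) := by gcongr; linarith
        _ = δ / 2 := by field_simp
  obtain ⟨-, ⟨P, hP, rfl⟩, hPc, -⟩ := hc.exists_between (b := c - t * (δ / 2))
    (by nlinarith [mul_pos h0 hδ])
  set R : Matrix ι ι ℂ := ((1 - t : ℝ) : ℂ) • W.output P + (t : ℂ) • ∑ y, W.state y with hR
  have hRps : R.PosSemidef := ((W.output_posSemidef hP.1).smul
    (by exact_mod_cast (by linarith : (0 : ℝ) ≤ 1 - t))).add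
    ((posSemidef_sum _ fun y _ => W.posSemidef y).smul (by exact_mod_cast h0.le))
  have hS : (R + (t : ℂ) • (1 : Matrix ι ι ℂ)).PosDef := posDef_add_smul_one hRps h0
  refine ⟨_, hS, fun x => ?_⟩
  have htr : (R + (t : ℂ) • (1 : Matrix ι ι ℂ)).trace.re = 1 - t + t * m := by
    simp only [hR, trace_add, trace_smul, trace_sum, W.trace_eq_one, W.trace_output hP, trace_one,
      smul_eq_mul, Finset.sum_const, Finset.card_univ, nsmul_eq_mul, Complex.add_re,
      Complex.re_ofReal_mul, mul_one, Complex.natCast_re, Complex.ofReal_re]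
    ring
  have hlog : Real.log (R + (t : ℂ) • (1 : Matrix ι ι ℂ)).trace.re ≤ δ / 2 := by
    rw [htr]
    have hpos : 0 < 1 - t + t * m := by nlinarith [mul_nonneg h0.le hm0]
    linarith [Real.log_le_sub_one_of_pos hpos]
  have hdiv := W.divergence_mix_le hub hP (η := δ / 2) (by linarith) h0 h1 hPc.le x
  have hx : (((1 - t : ℝ) : ℂ) • W.output P + (t : ℂ) • W.state x).PosSemidef :=
    ((W.output_posSemidef hP.1).smul
      (by exact_mod_cast (by linarith : (0 : ℝ) ≤ 1 - t))).add
      ((W.posSemidef x).smul (by exact_mod_cast h0.le))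
  have hmono := re_trace_mul_log_mono (W.posSemidef x) hx h0 (by
      rw [add_sub_cancel_right]
      exact (W.output_posSemidef hP.1).smul
        (by exact_mod_cast (by linarith : (0 : ℝ) ≤ 1 - t)))
    (B := R + (t : ℂ) • (1 : Matrix ι ι ℂ)) (by
      classical
      have : R + (t : ℂ) • (1 : Matrix ι ι ℂ) -
          (((1 - t : ℝ) : ℂ) • W.output P + (t : ℂ) • W.state x) =
          (t : ℂ) • (∑ y ∈ Finset.univ.erase x, W.state y + 1) := by
        rw [hR, ← Finset.add_sum_erase _ _ (Finset.mem_univ x), smul_add, smul_add]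
        abel
      rw [this]
      exact ((posSemidef_sum _ fun y _ => W.posSemidef y).add PosSemidef.one).smul
        (by exact_mod_cast h0.le))
  linarith

end Capacity

/-! ### Approximation of averages in a Hilbert space -/

section Sampling

variable {A E : Type*} [Fintype A] [NormedAddCommGroup E] [InnerProductSpace ℝ E]

theorem exists_norm_add_sub_mean_sq_le {P : A → ℝ} (hP : P ∈ stdSimplex ℝ A) {v : A → E} {R : ℝ}
    (hv : ∀ a, ‖v a‖ ^ 2 ≤ R) (S : E) :
    ∃ a, ‖S + (v a - ∑ a', P a' • v a')‖ ^ 2 ≤ ‖S‖ ^ 2 + R := by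
  set μ := ∑ a', P a' • v a' with hμ
  by_contra! h
  have h₁ : ∑ a, P a * (‖S‖ ^ 2 + R) < ∑ a, P a * ‖S + (v a - μ)‖ ^ 2 := by
    refine Finset.sum_lt_sum (fun a _ => mul_le_mul_of_nonneg_left (h a).le (hP.1 a)) ?_
    obtain ⟨a, -, ha⟩ := Finset.exists_ne_zero_of_sum_ne_zero
      (show ∑ a, P a ≠ 0 by rw [hP.2]; exact one_ne_zero)
    exact ⟨a, Finset.mem_univ a, mul_lt_mul_of_pos_left (h a) ((hP.1 a).lt_of_ne' ha)⟩
  have h₂ : ∀ a, P a * ‖S + (v a - μ)‖ ^ 2 =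
      P a * (‖S - μ‖ ^ 2) + 2 * inner ℝ (S - μ) (P a • v a) + P a * ‖v a‖ ^ 2 := by
    intro a
    rw [show S + (v a - μ) = (S - μ) + v a by abel, norm_add_sq_real, inner_smul_right]
    ring
  have h₃ : ∑ a, P a * ‖S + (v a - μ)‖ ^ 2 =
      ‖S - μ‖ ^ 2 + 2 * inner ℝ (S - μ) μ + ∑ a, P a * ‖v a‖ ^ 2 := by
    simp only [h₂, Finset.sum_add_distrib, ← Finset.mul_sum, ← inner_sum, ← hμ]
    rw [← Finset.sum_mul, hP.2, one_mul]
  have h₄ : ∑ a, P a * ‖v a‖ ^ 2 ≤ R := by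
    calc ∑ a, P a * ‖v a‖ ^ 2 ≤ ∑ a, P a * R :=
          Finset.sum_le_sum fun a _ => mul_le_mul_of_nonneg_left (hv a) (hP.1 a)
      _ = R := by rw [← Finset.sum_mul, hP.2, one_mul]
  have h₅ : ‖S‖ ^ 2 = ‖S - μ‖ ^ 2 + 2 * inner ℝ (S - μ) μ + ‖μ‖ ^ 2 := by
    rw [← norm_add_sq_real, sub_add_cancel]
  rw [← Finset.sum_mul, hP.2, one_mul, h₃] at h₁
  nlinarith [sq_nonneg ‖μ‖]

theorem exists_norm_sum_sub_mean_sq_le {P : A → ℝ} (hP : P ∈ stdSimplex ℝ A) {v : A → E} {R : ℝ}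
    (hv : ∀ a, ‖v a‖ ^ 2 ≤ R) (M : ℕ) :
    ∃ f : Fin M → A, ‖∑ m, (v (f m) - ∑ a, P a • v a)‖ ^ 2 ≤ M * R := by
  induction M with
  | zero => exact ⟨Fin.elim0, by simp⟩
  | succ M ih =>
    obtain ⟨f, hf⟩ := ih
    obtain ⟨a, ha⟩ := exists_norm_add_sub_mean_sq_le hP hv
      (∑ m, (v (f m) - ∑ a, P a • v a))
    refine ⟨Fin.snoc f a, ?_⟩
    rw [Fin.sum_univ_castSucc]
    simp only [Fin.snoc_castSucc, Fin.snoc_last]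
    push_cast
    linarith

/-- An average of vectors of norm at most `√R` is approximated by an unweighted average of `M` of
them, up to an error of `√(R / M)`. -/
theorem exists_norm_average_sub_mean_le {P : A → ℝ} (hP : P ∈ stdSimplex ℝ A) {v : A → E} {R : ℝ}
    (hv : ∀ a, ‖v a‖ ^ 2 ≤ R) {M : ℕ} (hM : 0 < M) :
    ∃ f : Fin M → A, ‖∑ m, (M : ℝ)⁻¹ • v (f m) - ∑ a, P a • v a‖ ≤ √(R / M) := by
  obtain ⟨f, hf⟩ := exists_norm_sum_sub_mean_sq_le hP hv M
  have hM' : (0 : ℝ) < M := by exact_mod_cast hM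
  refine ⟨f, Real.le_sqrt_of_sq_le ?_⟩
  have h : ∑ m, (M : ℝ)⁻¹ • v (f m) - ∑ a, P a • v a =
      (M : ℝ)⁻¹ • ∑ m, (v (f m) - ∑ a, P a • v a) := by
    rw [Finset.sum_sub_distrib, smul_sub, Finset.smul_sum, Finset.sum_const, Finset.card_univ,
      Fintype.card_fin, ← Nat.cast_smul_eq_nsmul ℝ, smul_smul, inv_mul_cancel₀ hM'.ne', one_smul]
  rw [h, norm_smul, mul_pow, Real.norm_eq_abs, sq_abs]
  calc ((M : ℝ)⁻¹) ^ 2 * _ ≤ ((M : ℝ)⁻¹) ^ 2 * (M * R) := by gcongr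
    _ = R / M := by field_simp

end Sampling

/-! ### One-shot covering -/

section Covering

open Matrix

variable {A J : Type*} [Fintype A] [Fintype J]

/-- The squared Hilbert–Schmidt norm. -/
def hsNormSq (Y : Matrix J J ℂ) : ℝ := ∑ i, ∑ j, ‖Y i j‖ ^ 2

theorem hsNormSq_eq_trace (Y : Matrix J J ℂ) : hsNormSq Y = (Y * Yᴴ).trace.re := by
  simp only [hsNormSq, trace, diag_apply, ← sum_norm_sq_eq_mul_conjTranspose,
    ← Complex.ofReal_sum, Complex.ofReal_re]

theorem hsNormSq_conjTranspose (Y : Matrix J J ℂ) : hsNormSq Yᴴ = hsNormSq Y := by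
  rw [hsNormSq_eq_trace, hsNormSq_eq_trace, trace_mul_comm, conjTranspose_conjTranspose]

theorem norm_trace_mul_le (Y Z : Matrix J J ℂ) :
    ‖(Y * Z).trace‖ ≤ √(hsNormSq Y) * √(hsNormSq Z) := by
  have h₁ : (Y * Z).trace = ∑ p : J × J, Y p.1 p.2 * Z p.2 p.1 := by
    simp [trace, Matrix.mul_apply, Fintype.sum_prod_type]
  have h₂ : hsNormSq Y = ∑ p : J × J, ‖Y p.1 p.2‖ ^ 2 := by
    simp [hsNormSq, Fintype.sum_prod_type]
  have h₃ : hsNormSq Z = ∑ p : J × J, ‖Z p.2 p.1‖ ^ 2 := by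
    rw [hsNormSq, Finset.sum_comm]
    simp [Fintype.sum_prod_type]
  rw [h₁, h₂, h₃]
  refine (norm_sum_le _ _).trans ?_
  simp only [norm_mul]
  exact Real.sum_mul_le_sqrt_mul_sqrt _ _ _

/-- The part of `K` on the entries where `w j ≤ R * s i`. -/
def truncate (K : Matrix J J ℂ) (w s : J → ℝ) (R : ℝ) : Matrix J J ℂ :=
  Matrix.of fun i j => if w j ≤ R * s i then K i j else 0

/-- The truncated state, weighted by `s ^ (-1/2)`, as a vector of the Hilbert–Schmidt space. -/
def weightedVector (K : Matrix J J ℂ) (w s : J → ℝ) (R : ℝ) : EuclideanSpace ℂ (J × J) :=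
  WithLp.toLp 2 fun p => (((√(s p.1))⁻¹ : ℝ) : ℂ) * (truncate K w s R * Kᴴ) p.1 p.2

/-- The functional `Y ↦ Re Tr (s ^ (1/2) Y D)` on the Hilbert–Schmidt space. -/
def weightedFunctional (s : J → ℝ) (D : Matrix J J ℂ) : EuclideanSpace ℂ (J × J) →ₗ[ℝ] ℝ where
  toFun u := ∑ p : J × J, (((√(s p.1) : ℝ) : ℂ) * u p * D p.2 p.1).re
  map_add' u v := by
    simp only [PiLp.add_apply, mul_add, add_mul, Complex.add_re, Finset.sum_add_distrib]
  map_smul' c u := by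
    simp only [PiLp.smul_apply, Finset.smul_sum, RingHom.id_apply]
    refine Finset.sum_congr rfl fun p _ => ?_
    rw [mul_smul_comm, smul_mul_assoc, Complex.smul_re]

theorem weightedFunctional_weightedVector (K D : Matrix J J ℂ) (w : J → ℝ) {s : J → ℝ} (R : ℝ)
    (hs : ∀ i, 0 < s i) : weightedFunctional s D (weightedVector K w s R) =
      (truncate K w s R * Kᴴ * D).trace.re := by
  have h : ∀ i, ((√(s i) : ℝ) : ℂ) * (((√(s i))⁻¹ : ℝ) : ℂ) = 1 := by
    intro i
    rw [← Complex.ofReal_mul, mul_inv_cancel₀ (Real.sqrt_ne_zero'.2 (hs i)), Complex.ofReal_one]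
  simp only [weightedFunctional, weightedVector, LinearMap.coe_mk, AddHom.coe_mk, trace, diag_apply,
    ← mul_assoc, h, one_mul, Fintype.sum_prod_type, Complex.re_sum]
  refine Finset.sum_congr rfl fun i _ => ?_
  rw [Matrix.mul_apply, Complex.re_sum]

variable [DecidableEq J]

/-- Multiplication by an effect does not increase the Hilbert–Schmidt norm. -/
theorem hsNormSq_effect_mul_le {D : Matrix J J ℂ} (h₀ : D.PosSemidef) (h₁ : (1 - D).PosSemidef)
    (Y : Matrix J J ℂ) : hsNormSq (D * Y) ≤ hsNormSq Y := by
  have h : (1 - D * D).PosSemidef := by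
    have e : 1 - D * D = (1 - D) + (Dᴴ * (1 - D) * D + (1 - D)ᴴ * D * (1 - D)) := by
      rw [h₀.1, h₁.1]
      noncomm_ring
    rw [e]
    exact h₁.add ((h₁.conjTranspose_mul_mul_same D).add (h₀.conjTranspose_mul_mul_same (1 - D)))
  have h₂ := re_trace_mul_nonneg (posSemidef_self_mul_conjTranspose Y) h
  rw [Matrix.mul_sub, Matrix.mul_one, trace_sub, Complex.sub_re, sub_nonneg] at h₂
  rw [hsNormSq_eq_trace, hsNormSq_eq_trace, conjTranspose_mul, h₀.1]
  refine le_trans (le_of_eq ?_) h₂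
  rw [Matrix.mul_assoc, trace_mul_comm]
  simp only [Matrix.mul_assoc]

theorem hsNormSq_mul_effect_le {D : Matrix J J ℂ} (h₀ : D.PosSemidef) (h₁ : (1 - D).PosSemidef)
    (Y : Matrix J J ℂ) : hsNormSq (Y * D) ≤ hsNormSq Y := by
  rw [← hsNormSq_conjTranspose, ← hsNormSq_conjTranspose Y, conjTranspose_mul, h₀.1]
  exact hsNormSq_effect_mul_le h₀ h₁ _

theorem hsNormSq_eq_sum_of_conjTranspose_mul_eq {K : Matrix J J ℂ} {w : J → ℝ}
    (hK : Kᴴ * K = diagonal (fun j => (w j : ℂ))) : hsNormSq K = ∑ j, w j := by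
  rw [← hsNormSq_conjTranspose, hsNormSq_eq_trace, conjTranspose_conjTranspose, hK, trace_diagonal]
  simp

theorem sum_norm_truncate_mul_sq (K : Matrix J J ℂ) {w : J → ℝ} (s : J → ℝ) (R : ℝ)
    (hK : Kᴴ * K = diagonal (fun j => (w j : ℂ))) (i : J) :
    ∑ k, ‖(truncate K w s R * Kᴴ) i k‖ ^ 2 = ∑ j, ‖truncate K w s R i j‖ ^ 2 * w j := by
  have h := sum_norm_sq_eq_mul_conjTranspose (truncate K w s R * Kᴴ) i
  rw [conjTranspose_mul, conjTranspose_conjTranspose, Matrix.mul_assoc, ← Matrix.mul_assoc Kᴴ, hK,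
    ← Matrix.mul_assoc, Matrix.mul_apply] at h
  simp only [mul_diagonal, conjTranspose_apply, Complex.star_def] at h
  have h' : ∀ j, truncate K w s R i j * (w j : ℂ) * (starRingEnd ℂ) (truncate K w s R i j) =
      ((‖truncate K w s R i j‖ ^ 2 * w j : ℝ) : ℂ) := by
    intro j
    rw [mul_right_comm, Complex.mul_conj, Complex.normSq_eq_norm_sq, Complex.ofReal_mul]
  simp only [h', ← Complex.ofReal_sum] at h
  exact_mod_cast h

theorem norm_weightedVector_sq_le {K : Matrix J J ℂ} {w s : J → ℝ} {R : ℝ} (hR : 0 ≤ R)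
    (hs : ∀ i, 0 < s i) (hK : Kᴴ * K = diagonal (fun j => (w j : ℂ)))
    (hw : ∑ j, w j = 1) : ‖weightedVector K w s R‖ ^ 2 ≤ R := by
  rw [EuclideanSpace.norm_sq_eq, Fintype.sum_prod_type]
  simp only [weightedVector, norm_mul, mul_pow, ← Finset.mul_sum, sum_norm_truncate_mul_sq K s R hK,
    Complex.norm_real, Real.norm_eq_abs, sq_abs, inv_pow, Real.sq_sqrt (hs _).le]
  calc ∑ i, (s i)⁻¹ * ∑ j, ‖truncate K w s R i j‖ ^ 2 * w j
      ≤ ∑ i, ∑ j, R * ‖K i j‖ ^ 2 := by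
        refine Finset.sum_le_sum fun i _ => ?_
        rw [Finset.mul_sum]
        refine Finset.sum_le_sum fun j _ => ?_
        by_cases h : w j ≤ R * s i
        · simp only [truncate, of_apply, h, if_true]
          have : (s i)⁻¹ * w j ≤ R := by
            rw [inv_mul_eq_div, div_le_iff₀ (hs i)]
            exact h
          nlinarith [mul_le_mul_of_nonneg_left this (sq_nonneg ‖K i j‖)]
        · simp only [truncate, of_apply, h, if_false, norm_zero]
          rw [zero_pow two_ne_zero, zero_mul, mul_zero]
          positivity
    _ = R * hsNormSq K := by simp only [hsNormSq, Finset.mul_sum]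
    _ = R := by rw [hsNormSq_eq_sum_of_conjTranspose_mul_eq hK, hw, mul_one]

theorem abs_re_trace_sub_truncate_le {K D : Matrix J J ℂ} {w s : J → ℝ} {R ε : ℝ}
    (hK : Kᴴ * K = diagonal (fun j => (w j : ℂ))) (hw : ∑ j, w j = 1)
    (hε : ∑ i, ∑ j, (if w j ≤ R * s i then 0 else ‖K i j‖ ^ 2) ≤ ε)
    (h₀ : D.PosSemidef) (h₁ : (1 - D).PosSemidef) :
    |(K * Kᴴ * D).trace.re - (truncate K w s R * Kᴴ * D).trace.re| ≤ √ε := by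
  have e : (K * Kᴴ * D).trace.re - (truncate K w s R * Kᴴ * D).trace.re =
      ((K - truncate K w s R) * (Kᴴ * D)).trace.re := by
    rw [Matrix.sub_mul, trace_sub, Complex.sub_re, Matrix.mul_assoc, Matrix.mul_assoc]
  have h₂ : hsNormSq (K - truncate K w s R) ≤ ε := by
    refine le_trans (le_of_eq ?_) hε
    refine Finset.sum_congr rfl fun i _ => Finset.sum_congr rfl fun j _ => ?_
    by_cases h : w j ≤ R * s i <;> simp [truncate, h]
  have h₃ : hsNormSq (Kᴴ * D) ≤ 1 := by
    refine (hsNormSq_mul_effect_le h₀ h₁ _).trans (le_of_eq ?_)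
    rw [hsNormSq_conjTranspose, hsNormSq_eq_sum_of_conjTranspose_mul_eq hK, hw]
  rw [e]
  calc _ ≤ √(hsNormSq (K - truncate K w s R)) * √(hsNormSq (Kᴴ * D)) :=
        (Complex.abs_re_le_norm _).trans (norm_trace_mul_le _ _)
    _ ≤ √ε * √1 := by gcongr
    _ = √ε := by simp

theorem abs_weightedFunctional_le {s : J → ℝ} {D : Matrix J J ℂ} (hs : ∀ i, 0 ≤ s i)
    (hs1 : ∑ i, s i ≤ 1) (h₀ : D.PosSemidef) (h₁ : (1 - D).PosSemidef)
    (u : EuclideanSpace ℂ (J × J)) : |weightedFunctional s D u| ≤ ‖u‖ := by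
  set Q : Matrix J J ℂ := diagonal (fun i => ((√(s i) : ℝ) : ℂ)) with hQ
  have hQ1 : hsNormSq Q ≤ 1 := by
    have : hsNormSq Q = ∑ i, s i := by
      rw [hsNormSq]
      refine Finset.sum_congr rfl fun i _ => ?_
      rw [Finset.sum_eq_single i]
      · rw [hQ, diagonal_apply_eq, Complex.norm_real, Real.norm_eq_abs, sq_abs,
          Real.sq_sqrt (hs i)]
      · intro j _ hj
        rw [hQ, diagonal_apply_ne _ (Ne.symm hj)]
        simp
      · simp
    rwa [this]
  have e : weightedFunctional s D u = (Matrix.of (fun i k => u (i, k)) * (D * Q)).trace.re := by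
    simp only [weightedFunctional, LinearMap.coe_mk, AddHom.coe_mk, trace, diag_apply,
      Fintype.sum_prod_type, Complex.re_sum, Matrix.mul_apply (M := Matrix.of _), hQ, mul_diagonal,
      of_apply]
    refine Finset.sum_congr rfl fun i _ => Finset.sum_congr rfl fun k _ => ?_
    congr 1
    ring
  have hu : hsNormSq (Matrix.of (fun i k => u (i, k))) = ‖u‖ ^ 2 := by
    rw [EuclideanSpace.norm_sq_eq, Fintype.sum_prod_type]
    rfl
  rw [e]
  calc _ ≤ √(hsNormSq (Matrix.of (fun i k => u (i, k)))) * √(hsNormSq (D * Q)) :=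
        (Complex.abs_re_le_norm _).trans (norm_trace_mul_le _ _)
    _ ≤ √(hsNormSq (Matrix.of (fun i k => u (i, k)))) * √1 := by
        gcongr
        exact (hsNormSq_effect_mul_le h₀ h₁ Q).trans hQ1
    _ = ‖u‖ := by rw [hu, Real.sqrt_one, mul_one, Real.sqrt_sq (norm_nonneg u)]

/-- One-shot covering: the output state of any input distribution is approximated, uniformly on
effects, by an unweighted average of `M` output states. -/
theorem exists_covering {K : A → Matrix J J ℂ} {w : A → J → ℝ} {s : J → ℝ} {R ε : ℝ} (hR : 0 ≤ R)
    (hs : ∀ i, 0 < s i) (hs1 : ∑ i, s i ≤ 1)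
    (hK : ∀ a, (K a)ᴴ * K a = diagonal (fun j => (w a j : ℂ))) (hw : ∀ a, ∑ j, w a j = 1)
    (hε : ∀ a, ∑ i, ∑ j, (if w a j ≤ R * s i then 0 else ‖K a i j‖ ^ 2) ≤ ε)
    {P : A → ℝ} (hP : P ∈ stdSimplex ℝ A) {M : ℕ} (hM : 0 < M) :
    ∃ f : Fin M → A, ∀ D : Matrix J J ℂ, D.PosSemidef → (1 - D).PosSemidef →
      |∑ m, (M : ℝ)⁻¹ * (K (f m) * (K (f m))ᴴ * D).trace.re -
        ∑ a, P a * (K a * (K a)ᴴ * D).trace.re| ≤ 2 * √ε + √(R / M) := by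
  obtain ⟨f, hf⟩ := exists_norm_average_sub_mean_le hP
    (fun a => norm_weightedVector_sq_le hR hs (hK a) (hw a)) hM
  refine ⟨f, fun D h₀ h₁ => ?_⟩
  have hM' : (0 : ℝ) < M := by exact_mod_cast hM
  have h₂ := (abs_weightedFunctional_le (fun i => (hs i).le) hs1 h₀ h₁ _).trans hf
  simp only [map_sub, map_sum, map_smul, weightedFunctional_weightedVector _ D _ R hs,
    smul_eq_mul] at h₂
  have h₃ := fun a => abs_re_trace_sub_truncate_le (hK a) (hw a) (hε a) h₀ h₁
  have h₄ : |∑ m, (M : ℝ)⁻¹ * ((K (f m) * (K (f m))ᴴ * D).trace.re -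
      (truncate (K (f m)) (w (f m)) s R * (K (f m))ᴴ * D).trace.re)| ≤ √ε := by
    refine (Finset.abs_sum_le_sum_abs _ _).trans ?_
    calc _ ≤ ∑ _m : Fin M, (M : ℝ)⁻¹ * √ε := by
          refine Finset.sum_le_sum fun m _ => ?_
          rw [abs_mul, abs_of_pos (inv_pos.2 hM')]
          exact mul_le_mul_of_nonneg_left (h₃ _) (inv_pos.2 hM').le
      _ = √ε := by
          rw [Finset.sum_const, Finset.card_univ, Fintype.card_fin, nsmul_eq_mul]
          field_simp
  have h₅ : |∑ a, P a * ((K a * (K a)ᴴ * D).trace.re -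
      (truncate (K a) (w a) s R * (K a)ᴴ * D).trace.re)| ≤ √ε := by
    refine (Finset.abs_sum_le_sum_abs _ _).trans ?_
    calc _ ≤ ∑ a, P a * √ε := by
          refine Finset.sum_le_sum fun a _ => ?_
          rw [abs_mul, abs_of_nonneg (hP.1 a)]
          exact mul_le_mul_of_nonneg_left (h₃ a) (hP.1 a)
      _ = √ε := by rw [← Finset.sum_mul, hP.2, one_mul]
  simp only [mul_sub, Finset.sum_sub_distrib] at h₄ h₅
  rw [abs_le] at *
  constructor <;> linarith [h₂.1, h₂.2, h₄.1, h₄.2, h₅.1, h₅.2]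

end Covering

/-! ### Tensor products -/

section TensorProd

open Matrix

variable {ι : Type*} {n : ℕ}

theorem prod_univ_sum_fun {ι R : Type*} [Fintype ι] [CommSemiring R] {n : ℕ} (f : Fin n → ι → R) :
    ∑ j : Fin n → ι, ∏ k, f k (j k) = ∏ k, ∑ i, f k i := by
  classical
  rw [Finset.prod_univ_sum, Fintype.piFinset_univ]

theorem tensorProd_conjTranspose (A : Fin n → Matrix ι ι ℂ) :
    (tensorProd A)ᴴ = tensorProd fun k => (A k)ᴴ := by
  ext i j
  simp [tensorProd, conjTranspose_apply]

theorem tensorProd_diagonal [DecidableEq ι] (d : Fin n → ι → ℂ) :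
    tensorProd (fun k => diagonal (d k)) = diagonal fun j => ∏ k, d k (j k) := by
  ext i j
  by_cases h : i = j
  · subst h
    simp [tensorProd]
  · obtain ⟨k, hk⟩ := Function.ne_iff.1 h
    rw [diagonal_apply_ne _ h, tensorProd, of_apply]
    exact Finset.prod_eq_zero (Finset.mem_univ k) (diagonal_apply_ne _ hk)

theorem tensorProd_one [DecidableEq ι] :
    tensorProd (fun _ : Fin n => (1 : Matrix ι ι ℂ)) = 1 := by
  simp only [← diagonal_one, tensorProd_diagonal, Finset.prod_const_one]

theorem tensorProd_mul [Fintype ι] (A B : Fin n → Matrix ι ι ℂ) :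
    tensorProd A * tensorProd B = tensorProd fun k => A k * B k := by
  ext i j
  simp only [tensorProd, Matrix.mul_apply, of_apply, ← Finset.prod_mul_distrib]
  exact prod_univ_sum_fun fun k m => A k (i k) m * B k m (j k)

end TensorProd

/-! ### Exponential moments -/

section Moments

open Filter Topology

theorem eventually_sum_mul_exp_le {Ω : Type*} [Fintype Ω] {q l : Ω → ℝ}
    (hq : q ∈ stdSimplex ℝ Ω) {c δ : ℝ} (hδ : 0 < δ) (hc : ∑ o, q o * l o ≤ c) :
    ∀ᶠ θ : ℝ in 𝓝[>] 0, ∑ o, q o * Real.exp (θ * l o) ≤ Real.exp (θ * (c + δ)) := by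
  set B : ℝ := ∑ o, |l o| with hB
  have hlB : ∀ o, |l o| ≤ B := fun o =>
    Finset.single_le_sum (f := fun o => |l o|) (fun _ _ => abs_nonneg _) (Finset.mem_univ o)
  have hB0 : 0 ≤ B := Finset.sum_nonneg fun _ _ => abs_nonneg _
  have h₁ : ∀ᶠ θ : ℝ in 𝓝[>] 0, θ * B < 1 := by
    refine eventually_nhdsWithin_of_eventually_nhds ?_
    exact (by fun_prop : Continuous fun θ : ℝ => θ * B).continuousAt.eventually_lt_const (by simp)
  have h₂ : ∀ᶠ θ : ℝ in 𝓝[>] 0, θ * B ^ 2 < δ := by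
    refine eventually_nhdsWithin_of_eventually_nhds ?_
    exact (by fun_prop : Continuous fun θ : ℝ => θ * B ^ 2).continuousAt.eventually_lt_const
      (by simpa)
  filter_upwards [h₁, h₂, self_mem_nhdsWithin] with θ h₁ h₂ (hθ : 0 < θ)
  have h₃ : ∀ o, Real.exp (θ * l o) ≤ 1 + θ * l o + θ ^ 2 * B ^ 2 := by
    intro o
    have ha : |θ * l o| ≤ θ * B := by
      rw [abs_mul, abs_of_pos hθ]
      exact mul_le_mul_of_nonneg_left (hlB o) hθ.le
    have hb := (abs_le.1 (Real.abs_exp_sub_one_sub_id_le (ha.trans h₁.le))).2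
    have hd : (θ * l o) ^ 2 ≤ (θ * B) ^ 2 := sq_le_sq' (abs_le.1 ha).1 (abs_le.1 ha).2
    nlinarith
  calc ∑ o, q o * Real.exp (θ * l o)
      ≤ ∑ o, (q o * (1 + θ ^ 2 * B ^ 2) + θ * (q o * l o)) := by
        refine Finset.sum_le_sum fun o _ => ?_
        nlinarith [mul_le_mul_of_nonneg_left (h₃ o) (hq.1 o)]
    _ = 1 + θ ^ 2 * B ^ 2 + θ * ∑ o, q o * l o := by
        rw [Finset.sum_add_distrib, ← Finset.sum_mul, ← Finset.mul_sum, hq.2, one_mul]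
    _ ≤ θ * (c + δ) + 1 := by
        nlinarith [mul_le_mul_of_nonneg_left hc hθ.le, mul_lt_mul_of_pos_left h₂ hθ]
    _ ≤ Real.exp (θ * (c + δ)) := Real.add_one_le_exp _

/-- Markov's inequality for the `θ`-th power of the likelihood ratio `w / s`. -/
theorem ite_le_mul_rpow {q w s R θ : ℝ} (hq : 0 ≤ q) (hw : 0 ≤ w) (hs : 0 < s) (hR : 0 < R)
    (hθ : 0 ≤ θ) :
    (if w ≤ R * s then 0 else q) ≤ (R ^ θ)⁻¹ * (q * (w / s) ^ θ) := by
  split_ifs with h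
  · positivity
  · have h₁ : R ≤ w / s := by
      rw [le_div_iff₀ hs]
      exact (not_le.1 h).le
    have h₂ : R ^ θ ≤ (w / s) ^ θ := Real.rpow_le_rpow hR.le h₁ hθ
    have h₃ : 0 < R ^ θ := Real.rpow_pos_of_pos hR θ
    rw [inv_mul_eq_div, le_div_iff₀ h₃]
    exact mul_le_mul_of_nonneg_left h₂ hq

end Moments

/-! ### Covering for the memoryless channel -/

section Block

open Matrix Filter Topology

variable {X ι : Type*} [Fintype X] [Fintype ι] [DecidableEq ι]

/-- A common diagonalization: in the basis given by `U`, the output states are `K K*` with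
`K* K` diagonal, and the likelihood ratios `w / s` have small moments of a positive order `θ`. -/
theorem CQChannel.exists_factorization (W : CQChannel X ι) {c : ℝ}
    (hc : IsLUB (W.holevoInfo '' stdSimplex ℝ X) c) {δ : ℝ} (hδ : 0 < δ) [Nonempty ι] :
    ∃ (U : Matrix ι ι ℂ) (K : X → Matrix ι ι ℂ) (w : X → ι → ℝ) (s : ι → ℝ) (θ : ℝ),
      Uᴴ * U = 1 ∧ (∀ x, K x * (K x)ᴴ = Uᴴ * W.state x * U) ∧
      (∀ x, (K x)ᴴ * K x = diagonal fun j => (w x j : ℂ)) ∧ (∀ x j, 0 ≤ w x j) ∧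
      (∀ x, ∑ j, w x j = 1) ∧ (∀ i, 0 < s i) ∧ ∑ i, s i = 1 ∧ 0 < θ ∧
      ∀ x, ∑ i, ∑ j, ‖K x i j‖ ^ 2 * (w x j / s i) ^ θ ≤ Real.exp (θ * (c + δ)) := by
  obtain ⟨S, hS, hdiv⟩ := W.exists_posDef_divergence_le hc (half_pos hδ)
  set T := S.trace.re with hT
  have hTsum : T = ∑ i, hS.1.eigenvalues i := re_trace_eq_sum_eigenvalues hS.1
  have hT0 : 0 < T := hTsum ▸ Finset.sum_pos (fun i _ => hS.eigenvalues_pos i)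
    Finset.univ_nonempty
  have hw1 : ∀ x, ∑ j, (W.posSemidef x).1.eigenvalues j = 1 := by
    intro x
    rw [← re_trace_eq_sum_eigenvalues, W.trace_eq_one, Complex.one_re]
  have hs0 : ∀ i, 0 < hS.1.eigenvalues i / T := fun i => div_pos (hS.eigenvalues_pos i) hT0
  have hq : ∀ x, (fun p : ι × ι => ‖sqrtOverlap hS.1 (W.posSemidef x).1 p.1 p.2‖ ^ 2) ∈
      stdSimplex ℝ (ι × ι) := by
    intro x
    refine ⟨fun p => by positivity, ?_⟩
    rw [Fintype.sum_prod_type]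
    exact (hsNormSq_eq_sum_of_conjTranspose_mul_eq
      (conjTranspose_mul_sqrtOverlap hS.1 (W.posSemidef x))).trans (hw1 x)
  have hev : ∀ᶠ θ : ℝ in 𝓝[>] 0, ∀ x, ∑ p : ι × ι,
      ‖sqrtOverlap hS.1 (W.posSemidef x).1 p.1 p.2‖ ^ 2 * Real.exp (θ *
        (Real.log ((W.posSemidef x).1.eigenvalues p.2) - Real.log (hS.1.eigenvalues p.1 / T))) ≤
      Real.exp (θ * (c + δ / 2 + δ / 2)) := by
    refine eventually_all.2 fun x => eventually_sum_mul_exp_le (hq x) (half_pos hδ) ?_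
    refine le_trans (le_of_eq ?_) (hdiv x)
    have h1 := (hq x).2
    rw [re_trace_mul_cfc hS.1 (W.posSemidef x),
      re_trace_mul_cfc_self_eq_sum_overlap hS.1 (W.posSemidef x)]
    simp only [← Fintype.sum_prod_type']
    conv_rhs => rw [← one_mul (Real.log T), ← h1, Finset.sum_mul]
    rw [← Finset.sum_sub_distrib, ← Finset.sum_add_distrib]
    refine Finset.sum_congr rfl fun p _ => ?_
    rw [Real.log_div (hS.eigenvalues_pos _).ne' hT0.ne']
    ring
  obtain ⟨θ, hθ, hθ0⟩ := (hev.and self_mem_nhdsWithin).exists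
  replace hθ0 : 0 < θ := hθ0
  refine ⟨hS.1.eigenvectorUnitary, fun x => sqrtOverlap hS.1 (W.posSemidef x).1,
    fun x => (W.posSemidef x).1.eigenvalues, fun i => hS.1.eigenvalues i / T, θ,
    eigenvectorUnitary_conjTranspose_mul_self _, fun x => sqrtOverlap_mul_conjTranspose _ (W.posSemidef x),
    fun x => conjTranspose_mul_sqrtOverlap _ (W.posSemidef x), fun x => (W.posSemidef x).eigenvalues_nonneg,
    hw1, hs0, ?_, hθ0, fun x => ?_⟩
  · rw [← Finset.sum_div, ← hTsum, div_self hT0.ne']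
  · have h2 := hθ x
    rw [add_assoc, add_halves] at h2
    refine le_trans (le_of_eq ?_) h2
    rw [Fintype.sum_prod_type]
    refine Finset.sum_congr rfl fun i _ => Finset.sum_congr rfl fun j _ => ?_
    rcases ((W.posSemidef x).eigenvalues_nonneg j).eq_or_lt with hw | hw
    · simp [norm_sqrtOverlap_sq hS.1 (W.posSemidef x), ← hw]
    · rw [Real.rpow_def_of_pos (div_pos hw (hs0 i)), Real.log_div hw.ne' (hs0 i).ne', mul_comm θ]

/-- Every output state of the memoryless channel is approximated, uniformly on effects, by an
unweighted average of `M` output states of words, if the rate of `M` exceeds `c`. -/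
theorem CQChannel.exists_block_covering (W : CQChannel X ι) {c : ℝ}
    (hc : IsLUB (W.holevoInfo '' stdSimplex ℝ X) c) {δ : ℝ} (hδ : 0 < δ) [Nonempty ι] :
    ∃ κ : ℝ, 0 < κ ∧ ∀ (n M : ℕ), 0 < M → ∀ P ∈ stdSimplex ℝ (Fin n → X),
      ∃ f : Fin M → Fin n → X, ∀ D : Matrix (Fin n → ι) (Fin n → ι) ℂ,
        D.PosSemidef → (1 - D).PosSemidef →
        |∑ m, (M : ℝ)⁻¹ * (W.blockState (f m) * D).trace.re -
          (W.blockOutput P * D).trace.re| ≤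
        2 * √(Real.exp (-(n * κ))) + √(Real.exp (n * (c + δ)) / M) := by
  obtain ⟨U, K, w, s, θ, hU, hKK, hK, hw, hw1, hs, hs1, hθ, hmom⟩ :=
    W.exists_factorization hc (half_pos hδ)
  refine ⟨θ * (δ / 2), by positivity, fun n M hM P hP => ?_⟩
  set R : ℝ := Real.exp (n * (c + δ)) with hR
  have htail : ∀ x : Fin n → X, ∑ i : Fin n → ι, ∑ j : Fin n → ι,
      (if ∏ k, w (x k) (j k) ≤ R * ∏ k, s (i k) then 0
        else ‖tensorProd (fun k => K (x k)) i j‖ ^ 2) ≤ Real.exp (-(n * (θ * (δ / 2)))) := by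
    intro x
    have h₁ : ∀ i j : Fin n → ι, (if ∏ k, w (x k) (j k) ≤ R * ∏ k, s (i k) then 0
        else ‖tensorProd (fun k => K (x k)) i j‖ ^ 2) ≤
        (R ^ θ)⁻¹ * ∏ k, (‖K (x k) (i k) (j k)‖ ^ 2 * (w (x k) (j k) / s (i k)) ^ θ) := by
      intro i j
      refine (ite_le_mul_rpow (by positivity) (Finset.prod_nonneg fun k _ => hw _ _)
        (Finset.prod_pos fun k _ => hs _) (Real.exp_pos _) hθ.le).trans (le_of_eq ?_)
      rw [Finset.prod_mul_distrib, Real.finsetProd_rpow _ _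
        (fun k _ => div_nonneg (hw _ _) (hs _).le), Finset.prod_div_distrib, Finset.prod_pow,
        tensorProd, of_apply, norm_prod]
    have h₂ : ∑ i : Fin n → ι, ∑ j : Fin n → ι,
        ∏ k, (‖K (x k) (i k) (j k)‖ ^ 2 * (w (x k) (j k) / s (i k)) ^ θ) ≤
        Real.exp (θ * (c + δ / 2)) ^ n := by
      calc _ = ∏ k, ∑ i, ∑ j, ‖K (x k) i j‖ ^ 2 * (w (x k) j / s i) ^ θ := by
            rw [← prod_univ_sum_fun]
            refine Finset.sum_congr rfl fun i _ => ?_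
            exact prod_univ_sum_fun fun k j => ‖K (x k) (i k) j‖ ^ 2 * (w (x k) j / s (i k)) ^ θ
        _ ≤ ∏ _k : Fin n, Real.exp (θ * (c + δ / 2)) := by
            refine Finset.prod_le_prod (fun k _ => ?_) fun k _ => hmom _
            exact Finset.sum_nonneg fun i _ => Finset.sum_nonneg fun j _ =>
              mul_nonneg (by positivity)
                (Real.rpow_nonneg (div_nonneg (hw _ _) (hs _).le) _)
        _ = _ := by simp
    calc _ ≤ ∑ i : Fin n → ι, ∑ j : Fin n → ι, (R ^ θ)⁻¹ *
          ∏ k, (‖K (x k) (i k) (j k)‖ ^ 2 * (w (x k) (j k) / s (i k)) ^ θ) :=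
          Finset.sum_le_sum fun i _ => Finset.sum_le_sum fun j _ => h₁ i j
      _ ≤ (R ^ θ)⁻¹ * Real.exp (θ * (c + δ / 2)) ^ n := by
          simp only [← Finset.mul_sum]
          exact mul_le_mul_of_nonneg_left h₂ (by positivity)
      _ = Real.exp (-(n * (θ * (δ / 2)))) := by
          rw [hR, ← Real.exp_mul, ← Real.exp_neg, ← Real.exp_nat_mul, ← Real.exp_add]
          congr 1
          ring
  obtain ⟨f, hf⟩ := exists_covering (K := fun x : Fin n → X => tensorProd fun k => K (x k))
    (w := fun x j => ∏ k, w (x k) (j k)) (s := fun i => ∏ k, s (i k)) (Real.exp_pos _).le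
    (fun i => Finset.prod_pos fun k _ => hs _)
    (by rw [prod_univ_sum_fun fun _ i => s i]; simp [hs1])
    (fun x => by
      simp only [tensorProd_conjTranspose, tensorProd_mul, hK, tensorProd_diagonal,
        Complex.ofReal_prod])
    (fun x => by rw [prod_univ_sum_fun fun k j => w (x k) j]; simp [hw1]) htail hP hM
  refine ⟨f, fun D h₀ h₁ => ?_⟩
  set V : Matrix (Fin n → ι) (Fin n → ι) ℂ := tensorProd fun _ => U with hV
  have hVV : Vᴴ * V = 1 := by
    rw [hV, tensorProd_conjTranspose, tensorProd_mul]
    simp only [hU, tensorProd_one]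
  have hVV' : V * Vᴴ = 1 := mul_eq_one_comm.1 hVV
  have hblock : ∀ x : Fin n → X, ((tensorProd fun k => K (x k)) *
      (tensorProd fun k => K (x k))ᴴ * (Vᴴ * D * V)).trace = (W.blockState x * D).trace := by
    intro x
    have e : (tensorProd fun k => K (x k)) * (tensorProd fun k => K (x k))ᴴ =
        Vᴴ * W.blockState x * V := by
      rw [hV, CQChannel.blockState]
      simp only [tensorProd_conjTranspose, tensorProd_mul, hKK]
    rw [e, trace_mul_comm, ← Matrix.mul_assoc, ← Matrix.mul_assoc, Matrix.mul_assoc (Vᴴ * D) V,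
      hVV', Matrix.mul_one, Matrix.mul_assoc, Matrix.mul_assoc, trace_mul_comm, Matrix.mul_assoc,
      Matrix.mul_assoc, hVV', Matrix.mul_one, trace_mul_comm]
  have hD := hf (Vᴴ * D * V) (h₀.conjTranspose_mul_mul_same V) (by
    have := h₁.conjTranspose_mul_mul_same V
    rwa [Matrix.mul_sub, Matrix.sub_mul, Matrix.mul_one, hVV] at this)
  simp only [hblock] at hD
  have hout : (W.blockOutput P * D).trace.re = ∑ x, P x * (W.blockState x * D).trace.re := by
    simp only [CQChannel.blockOutput, Matrix.sum_mul, Matrix.smul_mul, trace_sum, trace_smul,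
      Complex.re_sum, smul_eq_mul, Complex.re_ofReal_mul]
  rw [hout]
  exact hD

end Block

/-! ### The strong converse -/

section Converse

open Matrix Filter Topology

variable {X ι : Type*} [Fintype X] [Fintype ι]

theorem CQChannel.trace_blockState (W : CQChannel X ι) {n : ℕ} (x : Fin n → X) :
    (W.blockState x).trace = 1 := by
  have h := prod_univ_sum_fun fun k i => W.state (x k) i i
  have h1 : ∀ k, ∑ i, W.state (x k) i i = 1 := fun k => W.trace_eq_one (x k)
  simp only [h1, Finset.prod_const_one] at h
  exact h

theorem CQChannel.trace_blockOutput (W : CQChannel X ι) {n : ℕ} {P : (Fin n → X) → ℝ}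
    (hP : P ∈ stdSimplex ℝ (Fin n → X)) : (W.blockOutput P).trace = 1 := by
  simp only [CQChannel.blockOutput, trace_sum, trace_smul, W.trace_blockState, smul_eq_mul, mul_one]
  exact_mod_cast hP.2

variable [DecidableEq ι]

/-- If all output states are covered by averages of `M` output states, then two messages of a
large identification code share the same average, hence cannot be told apart. -/
theorem CQChannel.qidSizes_le_of_covering (W : CQChannel X ι) {n M : ℕ} {η l₁ l₂ : ℝ}
    (hcov : ∀ P ∈ stdSimplex ℝ (Fin n → X), ∃ f : Fin M → Fin n → X,
      ∀ D : Matrix (Fin n → ι) (Fin n → ι) ℂ, D.PosSemidef → (1 - D).PosSemidef →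
        |∑ m, (M : ℝ)⁻¹ * (W.blockState (f m) * D).trace.re - (W.blockOutput P * D).trace.re| ≤ η)
    (hη : l₁ + l₂ + 2 * η < 1) {N : ℕ} (hN : N ∈ W.qidSizes n l₁ l₂) :
    N ≤ (Fintype.card X ^ n) ^ M := by
  classical
  obtain ⟨P, D, hcode⟩ := hN
  choose f hf using fun i => hcov (P i) (hcode.prob i)
  by_contra! hlt
  obtain ⟨i, j, hij, hfij⟩ := Fintype.exists_ne_map_eq_of_card_lt f (by simpa using hlt)
  have h₁ := hf i (D i) (hcode.nonneg i) (hcode.le_one i)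
  have h₂ := hf j (D i) (hcode.nonneg i) (hcode.le_one i)
  have h₃ := hcode.first_kind i
  have h₄ := hcode.second_kind i j hij
  rw [Matrix.mul_sub, Matrix.mul_one, trace_sub, W.trace_blockOutput (hcode.prob i),
    Complex.sub_re, Complex.one_re] at h₃
  rw [hfij] at h₁
  rw [abs_le] at h₁ h₂
  linarith [h₁.1, h₁.2, h₂.1, h₂.2]

theorem tendsto_exp_neg_natCast_mul {a : ℝ} (ha : 0 < a) :
    Tendsto (fun n : ℕ => Real.exp (-(n * a))) atTop (𝓝 0) :=
  Real.tendsto_exp_neg_atTop_nhds_zero.comp (tendsto_natCast_atTop_atTop.atTop_mul_const ha)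

theorem eventually_pow_pow_ceil_le {b c d : ℝ} (hb : 1 < b) (hc : 0 ≤ c) (hd : 0 < d) (m : ℕ) :
    ∀ᶠ n : ℕ in atTop, (((m ^ n) ^ ⌈Real.exp (n * (c + 2 * d))⌉₊ : ℕ) : ℝ) ≤
      b ^ Real.exp (n * (c + 3 * d)) := by
  have hlogb : 0 < Real.log b := Real.log_pos hb
  rcases Nat.eq_zero_or_pos m with rfl | hm
  · filter_upwards [eventually_gt_atTop 0] with n hn
    have : 0 < ⌈Real.exp (n * (c + 2 * d))⌉₊ := Nat.ceil_pos.2 (Real.exp_pos _)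
    rw [zero_pow hn.ne', zero_pow this.ne', Nat.cast_zero]
    positivity
  have hm1 : (1 : ℝ) ≤ m := by exact_mod_cast hm
  have hlogm : 0 ≤ Real.log m := Real.log_nonneg hm1
  have hlim : Tendsto (fun n : ℕ => (n * d) * Real.exp (-(n * d))) atTop (𝓝 0) := by
    have := (Real.tendsto_pow_mul_exp_neg_atTop_nhds_zero 1).comp
      (tendsto_natCast_atTop_atTop.atTop_mul_const hd)
    simpa [Function.comp_def] using this
  have hev : ∀ᶠ n : ℕ in atTop,
      (n * d) * Real.exp (-(n * d)) * (2 * Real.log m) < d * Real.log b := by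
    have h := hlim.mul_const (2 * Real.log m)
    rw [zero_mul] at h
    exact h.eventually_lt_const (by positivity)
  filter_upwards [hev] with n hn
  have h₁ : (⌈Real.exp (n * (c + 2 * d))⌉₊ : ℝ) ≤ 2 * Real.exp (n * (c + 2 * d)) := by
    have h2 := (Nat.ceil_lt_add_one (Real.exp_pos (n * (c + 2 * d))).le).le
    have h3 : 1 ≤ Real.exp (n * (c + 2 * d)) := Real.one_le_exp (by positivity)
    linarith
  have h₂ : n * (2 * Real.log m) ≤ Real.log b * Real.exp (n * d) := by
    have h3 : d * (n * (2 * Real.log m)) * Real.exp (-(n * d)) < d * Real.log b := by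
      calc _ = (n * d) * Real.exp (-(n * d)) * (2 * Real.log m) := by ring
        _ < _ := hn
    rw [Real.exp_neg, ← div_eq_mul_inv, div_lt_iff₀ (Real.exp_pos _), mul_assoc] at h3
    exact (lt_of_mul_lt_mul_left h3 hd.le).le
  have hm0 : (0 : ℝ) < m := by linarith
  push_cast
  rw [← Real.log_le_log_iff (by positivity) (by positivity), Real.log_pow, Real.log_pow,
    Real.log_rpow (by linarith)]
  calc (⌈Real.exp (n * (c + 2 * d))⌉₊ : ℝ) * (n * Real.log m)
      ≤ 2 * Real.exp (n * (c + 2 * d)) * (n * Real.log m) := by gcongr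
    _ = Real.exp (n * (c + 2 * d)) * (n * (2 * Real.log m)) := by ring
    _ ≤ Real.exp (n * (c + 2 * d)) * (Real.log b * Real.exp (n * d)) := by gcongr
    _ = Real.exp (n * (c + 3 * d)) * Real.log b := by
        rw [show (n : ℝ) * (c + 3 * d) = n * (c + 2 * d) + n * d by ring, Real.exp_add]
        ring

theorem CQChannel.isLUB_holevoInfo [Nonempty X] {b : ℝ} (hb : 1 < b) (W : CQChannel X ι) :
    IsLUB (W.holevoInfo '' stdSimplex ℝ X) (Real.log b * W.capacity b) := by
  classical
  have hlogb : 0 < Real.log b := Real.log_pos hb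
  obtain ⟨x⟩ := ‹Nonempty X›
  have hne : (W.mutualInfo b '' stdSimplex ℝ X).Nonempty :=
    ⟨_, _, single_mem_stdSimplex ℝ x, rfl⟩
  have hbdd : BddAbove (W.mutualInfo b '' stdSimplex ℝ X) := by
    refine ⟨Fintype.card ι / Real.log b, ?_⟩
    rintro - ⟨P, hP, rfl⟩
    rw [W.mutualInfo_eq b hP.1]
    exact div_le_div_of_nonneg_right (W.holevoInfo_le_card hP) hlogb.le
  constructor
  · rintro - ⟨P, hP, rfl⟩
    have h := le_csSup hbdd ⟨P, hP, rfl⟩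
    rwa [W.mutualInfo_eq b hP.1, div_le_iff₀ hlogb, mul_comm] at h
  · intro u hu
    rw [mul_comm, ← le_div_iff₀ hlogb]
    refine csSup_le hne ?_
    rintro - ⟨P, hP, rfl⟩
    rw [W.mutualInfo_eq b hP.1]
    exact div_le_div_of_nonneg_right (hu ⟨P, hP, rfl⟩) hlogb.le

theorem CQChannel.holevoInfo_single [DecidableEq X] (W : CQChannel X ι) (x : X) :
    W.holevoInfo (Pi.single x 1) = 0 := by
  have h : W.output (Pi.single x 1) = W.state x := by
    rw [CQChannel.output, Finset.sum_eq_single x]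
    · simp
    · intro y _ hy
      simp [hy]
    · simp
  rw [CQChannel.holevoInfo, h, Finset.sum_eq_single x]
  · simp
  · intro y _ hy
    simp [hy]
  · simp

theorem CQChannel.eventually_qidSizes_le (W : CQChannel X ι) {b l₁ l₂ δ : ℝ} (hb : 1 < b)
    (hl : l₁ + l₂ < 1) (hδ : 0 < δ) :
    ∀ᶠ n : ℕ in atTop, ∀ N ∈ W.qidSizes n l₁ l₂,
      (N : ℝ) ≤ b ^ (b ^ ((n : ℝ) * (W.capacity b + δ))) := by
  classical
  rcases isEmpty_or_nonempty X with hX | hX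
  · filter_upwards [eventually_gt_atTop 0] with n hn N ⟨P, D, hcode⟩
    rcases Nat.eq_zero_or_pos N with rfl | hN
    · rw [Nat.cast_zero]
      positivity
    · have : IsEmpty (Fin n → X) := ⟨fun x => hX.elim (x ⟨0, hn⟩)⟩
      have h := (hcode.prob ⟨0, hN⟩).2
      simp at h
  have hι : Nonempty ι := by
    by_contra hι
    rw [not_nonempty_iff] at hι
    have h := W.trace_eq_one hX.some
    simp [trace] at h
  have hlogb : 0 < Real.log b := Real.log_pos hb
  have hlub := W.isLUB_holevoInfo hb
  set c := Real.log b * W.capacity b with hc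
  have hc0 : 0 ≤ c := hlub.1 ⟨_, single_mem_stdSimplex ℝ hX.some, W.holevoInfo_single _⟩
  obtain ⟨d, hd, hdδ⟩ : ∃ d : ℝ, 0 < d ∧ 3 * d = Real.log b * δ :=
    ⟨Real.log b * δ / 3, by positivity, by ring⟩
  obtain ⟨κ, hκ, hcov⟩ := W.exists_block_covering hlub hd
  have herr : Tendsto (fun n : ℕ => l₁ + l₂ +
      2 * (2 * √(Real.exp (-(n * κ))) + √(Real.exp (-(n * d))))) atTop (𝓝 (l₁ + l₂)) := by
    have h₁ := (Real.continuous_sqrt.tendsto 0).comp (tendsto_exp_neg_natCast_mul hκ)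
    have h₂ := (Real.continuous_sqrt.tendsto 0).comp (tendsto_exp_neg_natCast_mul hd)
    have h₃ := (((h₁.const_mul 2).add h₂).const_mul 2).const_add (l₁ + l₂)
    simpa [Function.comp_def] using h₃
  filter_upwards [herr.eventually_lt_const hl, eventually_pow_pow_ceil_le hb hc0 hd
    (Fintype.card X)] with n hn hcount N hN
  set M := ⌈Real.exp (n * (c + 2 * d))⌉₊ with hM
  have hM0 : 0 < M := Nat.ceil_pos.2 (Real.exp_pos _)
  have hratio : Real.exp (n * (c + d)) / M ≤ Real.exp (-(n * d)) := by
    have hM0' : (0 : ℝ) < M := by exact_mod_cast hM0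
    rw [div_le_iff₀ hM0']
    calc Real.exp (n * (c + d)) = Real.exp (-(n * d)) * Real.exp (n * (c + 2 * d)) := by
          rw [← Real.exp_add]
          congr 1
          ring
      _ ≤ Real.exp (-(n * d)) * M := by
          gcongr
          exact Nat.le_ceil _
  have hle := W.qidSizes_le_of_covering (hcov n M hM0) (l₁ := l₁) (l₂ := l₂) (by
    have := Real.sqrt_le_sqrt hratio
    linarith) hN
  have hexp : Real.exp (n * (c + 3 * d)) = b ^ ((n : ℝ) * (W.capacity b + δ)) := by
    rw [Real.rpow_def_of_pos (by linarith), hdδ, hc]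
    congr 1
    ring
  rw [← hexp]
  exact le_trans (by exact_mod_cast hle) hcount

theorem bddAbove_and_sSup_le {s : Set ℕ} {B : ℝ} (hB : 0 ≤ B) (h : ∀ N ∈ s, (N : ℝ) ≤ B) :
    BddAbove s ∧ ((sSup s : ℕ) : ℝ) ≤ B := by
  have hbdd : BddAbove s := ⟨⌊B⌋₊, fun N hN => Nat.le_floor (h N hN)⟩
  refine ⟨hbdd, ?_⟩
  rcases s.eq_empty_or_nonempty with rfl | hne
  · simpa using hB
  · exact h _ (Nat.sSup_mem hne hbdd)

end Converse

/-! ### Classical channels as diagonal classical–quantum channels -/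

section Classical

open Matrix

variable {X Y : Type*} [Fintype X] [Fintype Y] [DecidableEq Y]

theorem posSemidef_diagonal_ofReal {J : Type*} [DecidableEq J] {p : J → ℝ} (hp : ∀ y, 0 ≤ p y) :
    (diagonal fun y => (p y : ℂ)).PosSemidef :=
  PosSemidef.diagonal fun y => by
    rw [Pi.zero_apply, Complex.zero_le_real]
    exact hp y

theorem vonNeumannEntropy_diagonal (b : ℝ) {p : Y → ℝ} (hp : ∀ y, 0 ≤ p y) :
    vonNeumannEntropy b (diagonal fun y => (p y : ℂ)) = shannonEntropy b p := by
  have hps := posSemidef_diagonal_ofReal hp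
  have h := hps.1.roots_charpoly_eq_eigenvalues
  have hprod : ∏ y, (Polynomial.X - Polynomial.C (p y : ℂ)) = (Multiset.map
      (fun a => Polynomial.X - Polynomial.C a)
      (Multiset.map (fun y => (p y : ℂ)) Finset.univ.val)).prod := by
    rw [Multiset.map_map]
    rfl
  rw [charpoly_diagonal, hprod, Polynomial.roots_multiset_prod_X_sub_C] at h
  have h' : Multiset.map p Finset.univ.val = Multiset.map hps.1.eigenvalues Finset.univ.val := by
    refine Multiset.map_injective Complex.ofReal_injective ?_
    rw [Multiset.map_map, Multiset.map_map]
    exact h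
  rw [vonNeumannEntropy, re_trace_mul_cfc_self hps, shannonEntropy]
  have h2 := congrArg (fun m => (Multiset.map (fun t => t * Real.logb b t) m).sum) h'
  simp only [Multiset.map_map] at h2
  exact congrArg Neg.neg h2.symm

/-- The classical–quantum channel with the diagonal output states given by `V`. -/
def ClassicalChannel.toCQChannel (V : ClassicalChannel X Y) : CQChannel X Y where
  state x := diagonal fun y => (V.prob x y : ℂ)
  posSemidef x := posSemidef_diagonal_ofReal (V.prob_mem x).1
  trace_eq_one x := by
    rw [trace_diagonal]
    exact_mod_cast (V.prob_mem x).2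

theorem ClassicalChannel.output_toCQChannel (V : ClassicalChannel X Y) (P : X → ℝ) :
    V.toCQChannel.output P = diagonal fun y => (V.output P y : ℂ) := by
  ext i j
  by_cases h : i = j
  · subst h
    simp [CQChannel.output, toCQChannel, ClassicalChannel.output, Matrix.sum_apply]
  · simp [CQChannel.output, toCQChannel, Matrix.sum_apply, h]

theorem ClassicalChannel.capacity_toCQChannel (b : ℝ) (V : ClassicalChannel X Y) :
    V.toCQChannel.capacity b = V.capacity b := by
  refine congrArg sSup (Set.image_congr fun P hP => ?_)
  rw [CQChannel.mutualInfo, ClassicalChannel.mutualInfo, V.output_toCQChannel,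
    vonNeumannEntropy_diagonal b (p := V.output P) fun y =>
      Finset.sum_nonneg fun x _ => mul_nonneg (hP.1 x) ((V.prob_mem x).1 y)]
  congr 1
  refine Finset.sum_congr rfl fun x _ => ?_
  rw [← vonNeumannEntropy_diagonal b (V.prob_mem x).1]
  rfl

/-- The projection on the span of the basis vectors in `S`. -/
def diagonalProj {J : Type*} [DecidableEq J] (S : Finset J) : Matrix J J ℂ :=
  diagonal fun y => ((if y ∈ S then 1 else 0 : ℝ) : ℂ)

theorem diagonalProj_posSemidef {J : Type*} [DecidableEq J] (S : Finset J) :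
    (diagonalProj S).PosSemidef :=
  PosSemidef.diagonal fun y => by
    rw [Pi.zero_apply, Complex.zero_le_real]
    split_ifs <;> norm_num

theorem one_sub_diagonalProj {J : Type*} [Fintype J] [DecidableEq J] (S : Finset J) :
    1 - diagonalProj S = diagonalProj Sᶜ := by
  rw [diagonalProj, diagonalProj, ← diagonal_one, diagonal_sub]
  congr 1
  funext y
  by_cases h : y ∈ S <;> simp [h]

theorem ClassicalChannel.re_trace_blockOutput_mul_diagonalProj (V : ClassicalChannel X Y) {n : ℕ}
    (P : (Fin n → X) → ℝ) (S : Finset (Fin n → Y)) :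
    (V.toCQChannel.blockOutput P * diagonalProj S).trace.re = V.blockProb P S := by
  simp only [CQChannel.blockOutput, CQChannel.blockState, toCQChannel, tensorProd_diagonal,
    Matrix.sum_mul, Matrix.smul_mul, trace_sum, trace_smul, Complex.re_sum, smul_eq_mul,
    Complex.re_ofReal_mul, diagonalProj, diagonal_mul_diagonal, trace_diagonal,
    ← Complex.ofReal_prod, ← Complex.ofReal_mul, Complex.ofReal_re, ClassicalChannel.blockProb]
  refine Finset.sum_congr rfl fun x _ => ?_
  simp

theorem ClassicalChannel.idSizes_subset (V : ClassicalChannel X Y) (n : ℕ) (l₁ l₂ : ℝ) :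
    V.idSizes n l₁ l₂ ⊆ V.toCQChannel.qidSizes n l₁ l₂ := by
  rintro N ⟨P, D, hcode⟩
  refine ⟨P, fun i => diagonalProj (D i), hcode.prob, fun i => diagonalProj_posSemidef _,
    fun i => ?_, fun i => ?_, fun i j hij => ?_⟩
  · rw [one_sub_diagonalProj]
    exact diagonalProj_posSemidef _
  · rw [one_sub_diagonalProj, V.re_trace_blockOutput_mul_diagonalProj]
    exact hcode.first_kind i
  · rw [V.re_trace_blockOutput_mul_diagonalProj]
    exact hcode.second_kind i j hij

end Classical

end QID

end

theorem mainTheorem1 {X ι Y : Type*} [Fintype X] [Fintype ι] [DecidableEq ι]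
    [Fintype Y] [DecidableEq Y]
    (b : ℝ) (hb : 1 < b)
    (l₁ l₂ : ℝ) (hl₁ : 0 < l₁) (hl₂ : 0 < l₂) (hl : l₁ + l₂ < 1) :
    (∀ W : QID.CQChannel X ι, ∀ δ : ℝ, 0 < δ → ∃ n₀ : ℕ, ∀ n : ℕ, n₀ ≤ n →
      BddAbove (W.qidSizes n l₁ l₂) ∧
      (W.maxQIDSize n l₁ l₂ : ℝ) ≤ b ^ (b ^ ((n : ℝ) * (W.capacity b + δ)))) ∧
    (∀ V : QID.ClassicalChannel X Y, ∀ δ : ℝ, 0 < δ → ∃ n₀ : ℕ, ∀ n : ℕ, n₀ ≤ n →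
      BddAbove (V.idSizes n l₁ l₂) ∧
      (V.maxIDSize n l₁ l₂ : ℝ) ≤ b ^ (b ^ ((n : ℝ) * (V.capacity b + δ)))) := by
  have hpos : ∀ t : ℝ, 0 ≤ b ^ t := fun t => Real.rpow_nonneg (by linarith) t
  refine ⟨fun W δ hδ => ?_, fun V δ hδ => ?_⟩
  · obtain ⟨n₀, h⟩ := Filter.eventually_atTop.1 (W.eventually_qidSizes_le hb hl hδ)
    exact ⟨n₀, fun n hn => QID.bddAbove_and_sSup_le (hpos _) (h n hn)⟩
  · obtain ⟨n₀, h⟩ :=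
      Filter.eventually_atTop.1 (V.toCQChannel.eventually_qidSizes_le hb hl hδ)
    refine ⟨n₀, fun n hn => QID.bddAbove_and_sSup_le (hpos _) fun N hN => ?_⟩
    rw [← V.capacity_toCQChannel b]
    exact h n hn N (V.idSizes_subset n l₁ l₂ hN)
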